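/- Let $p$ be a prime number, $F$ a non-archimedean local field with residue field of characteristic $p$, ring of integers $\mathcal O$, maximal ideal $\mathfrak p$ and a fixed uniformizer $\varpi$, and let $k$ be an algebraically closed field of characteristic $p$. Put $G=\mathrm{GL}_2(F)$, $K=\mathrm{GL}_2(\mathcal O)$, let $Z$ be the centre of $G$, $I\subset K$ the subgroup of matrices that are upper triangular modulo $\mathfrak p$, $N$ the normalizer of $I$ in $G$, $P^+=\begin{pmatrix}\mathcal O\setminus\{0\}&\mathcal O\\0&1\end{pmatrix}$ and $\Pi=\begin{pmatrix}0&1\\ \varpi&0\end{pmatrix}$. All representations are on $k$-vector spaces; a representation is smooth if every vector is fixed by an open subgroup. A diagram is a triple $(D_0,D_1,r)$ with $D_0$ a smooth representation of $KZ$, $D_1$ a smooth representation of $N$ and $r:D_1\to D_0$ a linear $IZ$-equivariant map; a morphism $(D_0,D_1,r)\to(D_0',D_1',r')$ is a pair $(\varphi_0,\varphi_1)$ of a $KZ$-equivariant linear map $\varphi_0:D_0\to D_0'$ and an $N$-equivariant linear map $\varphi_1:D_1\to D_1'$ with $\varphi_0\circ r=r'\circ\varphi_1$. Diagrams form a category $\mathrm{DIAG}$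 whose Hom sets are $k$-vector spaces. For a smooth representation $\pi'$ of $G$ put $\mathcal K(\pi')=(\pi'|_{KZ},\pi'|_N,\mathrm{id})$. Let $\pi$ be an irreducible smooth representation of $G$ with a central character. Then $\pi|_{KZ}$ has an irreducible subrepresentation. Let $\sigma\subset\pi|_{KZ}$ be any one, and put $$I^+(\pi)=\langle P^+\cdot\sigma\rangle,\quad I^-(\pi)=\Pi\cdot I^+(\pi),\quad D_1(\pi)=I^+(\pi)\cap I^-(\pi),\quad D_0(\pi)=\langle K\cdot D_1(\pi)\rangle\subset\pi,$$ where $\langle\cdot\rangle$ is the $k$-linear span; let $D(\pi)=(D_0(\pi),D_1(\pi),\mathrm{can})$, with $\mathrm{can}$ the inclusion, be the canonical diagram of $\pi$. Then, for every smooth representation $\pi'$ of $G$ (not necessarily irreducible), there is an isomorphism of $k$-vector spaces, natural in $\pi'$, $$\mathrm{Hom}_{\mathrm{DIAG}}(D(\pi),\mathcal K(\pi'))\;\cong\;\mathrm{Hom}_G(\pi,\pi'),$$ whose inverse sends $\varphi:\pi\to\pi'$ to the composite of the inclusion $D(\pi)\hookrightarrow\mathcal K(\pi)$ with $\mathcal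 K(\varphi):\mathcal K(\pi)\to\mathcal K(\pi')$. -/

import Mathlib

open scoped ValuativeRel

noncomputable section

open ValuativeRel Matrix

namespace CanonicalDiagram


section Groups

variable (F : Type*) [Field F] [ValuativeRel F] 

/-- `K = GL₂(𝒪)`, as a subgroup of `G = GL₂(F)`. -/
def maxCompact : Subgroup (GL (Fin 2) F) :=
  (Matrix.GeneralLinearGroup.map (n := Fin 2) (algebraMap 𝒪[F] F)).range

variable {F}

theorem mem_maxCompact {g : GL (Fin 2) F} :
    g ∈ maxCompact F ↔ (∀ i j, valuation F (g.1 i j) ≤ 1) ∧ valuation F g.1.det = 1 := by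
  constructor
  · rintro ⟨h, rfl⟩
    refine ⟨fun i j => (h.1 i j).2, ?_⟩
    have h1 : ((GeneralLinearGroup.map (algebraMap 𝒪[F] F) h).1).det
        = algebraMap 𝒪[F] F h.1.det := by
      rw [RingHom.map_det]; rfl
    rw [h1]
    exact (Valuation.integer.integers (valuation F)).one_of_isUnit
      ((Matrix.isUnit_iff_isUnit_det _).1 h.isUnit)
  · rintro ⟨h1, h2⟩
    let A : Matrix (Fin 2) (Fin 2) 𝒪[F] := Matrix.of fun i j => ⟨g.1 i j, h1 i j⟩
    have hA : algebraMap 𝒪[F] F A.det = g.1.det := by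
      rw [RingHom.map_det]; rfl
    have hu : IsUnit A.det :=
      (Valuation.integer.integers (valuation F)).isUnit_of_one' (by rw [hA]; exact h2)
    refine ⟨GeneralLinearGroup.mk'' A hu, ?_⟩
    apply GeneralLinearGroup.ext
    intro i j
    rfl

theorem inv_apply_one_zero (g : GL (Fin 2) F) :
    (g⁻¹).1 1 0 = -(g.1.det)⁻¹ * g.1 1 0 := by
  have h : (g⁻¹).1 = (g.1)⁻¹ := GeneralLinearGroup.coe_inv g
  rw [h, Matrix.inv_def, Matrix.adjugate_fin_two]
  simp

variable (F) in
/-- The Iwahori subgroup `I ⊆ K` of the matrices that are upper triangular modulo `𝔭`. -/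
def iwahori : Subgroup (GL (Fin 2) F) where
  carrier := {g | g ∈ maxCompact F ∧ valuation F (g.1 1 0) < 1}
  one_mem' := ⟨one_mem _, by simp⟩
  mul_mem' := by
    rintro a b ⟨ha, ha'⟩ ⟨hb, hb'⟩
    refine ⟨mul_mem ha hb, ?_⟩
    rw [GeneralLinearGroup.coe_mul, Matrix.mul_apply, Fin.sum_univ_two]
    apply Valuation.map_add_lt
    · rw [map_mul]
      exact (mul_le_of_le_one_right' ((mem_maxCompact.1 hb).1 0 0)).trans_lt ha'
    · rw [map_mul]
      exact (mul_le_of_le_one_left' ((mem_maxCompact.1 ha).1 1 1)).trans_lt hb'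
  inv_mem' := by
    rintro a ⟨ha, ha'⟩
    refine ⟨inv_mem ha, ?_⟩
    rw [inv_apply_one_zero, map_mul, Valuation.map_neg, map_inv₀, (mem_maxCompact.1 ha).2]
    simpa using ha'

variable (F) in
/-- `KZ`, with `Z` the centre of `G`. -/
def KZ : Subgroup (GL (Fin 2) F) := maxCompact F ⊔ Subgroup.center (GL (Fin 2) F)

variable (F) in
/-- `IZ`. -/
def IZ : Subgroup (GL (Fin 2) F) := iwahori F ⊔ Subgroup.center (GL (Fin 2) F)

variable (F) in
/-- `N`, the normalizer of `I` in `G`. -/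
def N : Subgroup (GL (Fin 2) F) := Subgroup.normalizer (iwahori F : Set (GL (Fin 2) F))

theorem iwahori_le_maxCompact : iwahori F ≤ maxCompact F := fun _ h => h.1

theorem IZ_le_KZ : IZ F ≤ KZ F := sup_le_sup_right iwahori_le_maxCompact _

theorem center_le_N : Subgroup.center (GL (Fin 2) F) ≤ N F :=
  Subgroup.center_le_normalizer _

theorem IZ_le_N : IZ F ≤ N F := sup_le Subgroup.le_normalizer center_le_N

variable (F) in
/-- The monoid `P⁺` of the matrices `(a b; 0 1)` with `a ∈ 𝒪 - {0}` and `b ∈ 𝒪`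
(`a ≠ 0` because the matrix is invertible). -/
def Pplus : Submonoid (GL (Fin 2) F) where
  carrier := {g | g.1 0 0 ∈ 𝒪[F] ∧ g.1 0 1 ∈ 𝒪[F] ∧ g.1 1 0 = 0 ∧ g.1 1 1 = 1}
  one_mem' := by simp [one_mem, zero_mem]
  mul_mem' := by
    rintro a b ⟨ha, ha1, ha2, ha3⟩ ⟨hb, hb1, hb2, hb3⟩
    simp only [Set.mem_ofPred_eq, GeneralLinearGroup.coe_mul, Matrix.mul_apply, Fin.sum_univ_two,
      ha2, ha3, hb2, hb3, mul_zero, add_zero, zero_mul, zero_add, mul_one, and_self, and_true]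
    exact ⟨mul_mem ha hb, add_mem (mul_mem ha hb1) ha1⟩

/-- The matrix `Π = (0 1; ϖ 0)` of `G`. -/
def PiMat (ϖ : 𝒪[F]) (hϖ : Irreducible ϖ) : GL (Fin 2) F :=
  GeneralLinearGroup.mkOfDetNeZero !![0, 1; (ϖ : F), 0] (by
    have := hϖ.ne_zero
    simpa [Matrix.det_fin_two] using this)

end Groups

section NormalizerOfIwahori

variable {F : Type*} [Field F] [ValuativeRel F] [TopologicalSpace F] [IsNonarchimedeanLocalField F]

theorem exists_valuation_eq_zpow {ϖ : 𝒪[F]} (hϖ : Irreducible ϖ) {x : F} (hx : x ≠ 0) :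
    ∃ n : ℤ, valuation F x = valuation F (ϖ : F) ^ n := by
  obtain ⟨n, u, hu⟩ :=
    IsDiscreteValuationRing.exists_units_eq_smul_zpow_of_irreducible hϖ hx
  refine ⟨n, ?_⟩
  rw [hu, Units.smul_def, Algebra.smul_def, map_mul, map_zpow₀,
    (Valuation.integer.integers (valuation F)).valuation_unit u, one_mul]
  rfl


theorem valuation_le_zpow {ϖ : 𝒪[F]} (hϖ : Irreducible ϖ) {x : F} {s t m : ℤ}
    (h : valuation F x ^ 2 * valuation F (ϖ : F) ^ s < valuation F (ϖ : F) ^ t)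
    (hm : 2 * m ≤ t - s + 2) : valuation F x ≤ valuation F (ϖ : F) ^ m := by
  have h0 : 0 < valuation F (ϖ : F) := Valuation.integer.v_irreducible_pos hϖ
  have h1 : valuation F (ϖ : F) < 1 := Valuation.integer.v_irreducible_lt_one hϖ
  by_cases hx : x = 0
  · simp [hx]
  obtain ⟨j, hj⟩ := exists_valuation_eq_zpow hϖ hx
  rw [hj, ← zpow_natCast, ← _root_.zpow_mul, ← zpow_add₀ h0.ne',
    zpow_lt_zpow_iff_right_of_lt_one₀ h0 h1] at h
  rw [hj, zpow_le_zpow_iff_right_of_lt_one₀ h0 h1]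
  push_cast at h
  omega

theorem scalar_mem_center (u : Fˣ) :
    GeneralLinearGroup.scalar (Fin 2) u ∈ Subgroup.center (GL (Fin 2) F) :=
  Subgroup.mem_center_iff.2 fun g => (GeneralLinearGroup.scalar_commute u g).symm

theorem mul_mul_inv_entries (g h : GL (Fin 2) F) :
    (g * h * g⁻¹).1 0 1 = g.1.det⁻¹ * (-(g.1 0 0 * h.1 0 0 + g.1 0 1 * h.1 1 0) * g.1 0 1
        + (g.1 0 0 * h.1 0 1 + g.1 0 1 * h.1 1 1) * g.1 0 0) ∧
    (g * h * g⁻¹).1 1 0 = g.1.det⁻¹ * ((g.1 1 0 * h.1 0 0 + g.1 1 1 * h.1 1 0) * g.1 1 1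
        - (g.1 1 0 * h.1 0 1 + g.1 1 1 * h.1 1 1) * g.1 1 0) := by
  have h' : (g⁻¹).1 = (g.1)⁻¹ := GeneralLinearGroup.coe_inv g
  constructor <;>
  · rw [GeneralLinearGroup.coe_mul, GeneralLinearGroup.coe_mul, h', Matrix.inv_def,
      Matrix.adjugate_fin_two]
    simp [Matrix.mul_apply, Fin.sum_univ_two]
    ring

/-- `N` is generated by `I`, `Π` and `Z`. -/
theorem exists_of_mem_N {ϖ : 𝒪[F]} (hϖ : Irreducible ϖ) {g : GL (Fin 2) F} (hg : g ∈ N F) :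
    ∃ z ∈ Subgroup.center (GL (Fin 2) F), ∃ h ∈ iwahori F,
      g = z * h ∨ g = z * (PiMat ϖ hϖ * h) := by
  have h0 : 0 < valuation F (ϖ : F) := Valuation.integer.v_irreducible_pos hϖ
  have h1 : valuation F (ϖ : F) < 1 := Valuation.integer.v_irreducible_lt_one hϖ
  have hϖ0 : (ϖ : F) ≠ 0 := by simpa using hϖ.ne_zero
  have hΔ : g.1.det ≠ 0 := GeneralLinearGroup.det_ne_zero g
  have hvΔ : 0 < valuation F g.1.det := by simpa [zero_lt_iff] using hΔ
  obtain ⟨n, hn⟩ := exists_valuation_eq_zpow hϖ hΔ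
  have hlt : valuation F (ϖ : F) ^ n < valuation F (ϖ : F) ^ (n - 1) := by
    rw [zpow_lt_zpow_iff_right_of_lt_one₀ h0 h1]; omega
  let u : GL (Fin 2) F := GeneralLinearGroup.mkOfDetNeZero !![1, 1; 0, 1]
    (by simp [Matrix.det_fin_two])
  let w : GL (Fin 2) F := GeneralLinearGroup.mkOfDetNeZero !![1, 0; (ϖ : F), 1]
    (by simp [Matrix.det_fin_two])
  have huval : u.1 = !![1, 1; 0, 1] := rfl
  have hwval : w.1 = !![1, 0; (ϖ : F), 1] := rfl
  have hu : u ∈ iwahori F := by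
    refine ⟨mem_maxCompact.2 ⟨?_, ?_⟩, ?_⟩ <;> simp [huval, Matrix.det_fin_two, Fin.forall_fin_two]
  have hw : w ∈ iwahori F := by
    refine ⟨mem_maxCompact.2 ⟨?_, ?_⟩, ?_⟩ <;>
      simp [hwval, Matrix.det_fin_two, Fin.forall_fin_two, h1, h1.le]
  have hgu : g * u * g⁻¹ ∈ iwahori F := (hg u).1 hu
  have hgw : g * w * g⁻¹ ∈ iwahori F := (hg w).1 hw
  have hu1 := (mem_maxCompact.1 hgu.1).1 0 1
  have hu2 := hgu.2
  have hw1 := (mem_maxCompact.1 hgw.1).1 0 1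
  have hw2 := hgw.2
  rw [(mul_mul_inv_entries g u).1] at hu1
  rw [(mul_mul_inv_entries g u).2] at hu2
  rw [(mul_mul_inv_entries g w).1] at hw1
  rw [(mul_mul_inv_entries g w).2] at hw2
  have eu1 : g.1.det⁻¹ * (-(g.1 0 0 * u.1 0 0 + g.1 0 1 * u.1 1 0) * g.1 0 1
        + (g.1 0 0 * u.1 0 1 + g.1 0 1 * u.1 1 1) * g.1 0 0) = g.1.det⁻¹ * g.1 0 0 ^ 2 := by
    simp only [huval, Matrix.of_apply, Matrix.cons_val]; ring
  have eu2 : g.1.det⁻¹ * ((g.1 1 0 * u.1 0 0 + g.1 1 1 * u.1 1 0) * g.1 1 1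
        - (g.1 1 0 * u.1 0 1 + g.1 1 1 * u.1 1 1) * g.1 1 0)
        = -(g.1.det⁻¹ * g.1 1 0 ^ 2) := by
    simp [huval]; ring
  have ew1 : g.1.det⁻¹ * (-(g.1 0 0 * w.1 0 0 + g.1 0 1 * w.1 1 0) * g.1 0 1
        + (g.1 0 0 * w.1 0 1 + g.1 0 1 * w.1 1 1) * g.1 0 0)
        = -(g.1.det⁻¹ * (g.1 0 1 ^ 2 * ϖ)) := by
    simp [hwval]; ring
  have ew2 : g.1.det⁻¹ * ((g.1 1 0 * w.1 0 0 + g.1 1 1 * w.1 1 0) * g.1 1 1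
        - (g.1 1 0 * w.1 0 1 + g.1 1 1 * w.1 1 1) * g.1 1 0)
        = g.1.det⁻¹ * (g.1 1 1 ^ 2 * ϖ) := by
    simp only [hwval, Matrix.of_apply, Matrix.cons_val]; ring
  rw [eu1, map_mul, map_inv₀, inv_mul_le_iff₀ hvΔ, mul_one, hn, map_pow] at hu1
  rw [eu2, Valuation.map_neg, map_mul, map_inv₀, inv_mul_lt_iff₀ hvΔ, mul_one, hn, map_pow] at hu2
  rw [ew1, Valuation.map_neg, map_mul, map_inv₀, inv_mul_le_iff₀ hvΔ, mul_one, hn, map_mul,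
    map_pow] at hw1
  rw [ew2, map_mul, map_inv₀, inv_mul_lt_iff₀ hvΔ, mul_one, hn, map_mul, map_pow] at hw2
  have ha (m : ℤ) (hm : 2 * m ≤ n + 1) : valuation F (g.1 0 0) ≤ valuation F (ϖ : F) ^ m :=
    valuation_le_zpow hϖ (s := 0) (t := n - 1) (by simpa using hu1.trans_lt hlt) (by omega)
  have hc (m : ℤ) (hm : 2 * m ≤ n + 2) : valuation F (g.1 1 0) ≤ valuation F (ϖ : F) ^ m :=
    valuation_le_zpow hϖ (s := 0) (t := n) (by simpa using hu2) (by omega)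
  have hb (m : ℤ) (hm : 2 * m ≤ n) : valuation F (g.1 0 1) ≤ valuation F (ϖ : F) ^ m :=
    valuation_le_zpow hϖ (s := 1) (t := n - 1) (by simpa using hw1.trans_lt hlt) (by omega)
  have hd (m : ℤ) (hm : 2 * m ≤ n + 1) : valuation F (g.1 1 1) ≤ valuation F (ϖ : F) ^ m :=
    valuation_le_zpow hϖ (s := 1) (t := n) (by simpa using hw2) (by omega)
  have key (x : F) (m r : ℤ) (hx : valuation F x ≤ valuation F (ϖ : F) ^ m) (hr : r ≤ m) :
      valuation F (((ϖ : F) ^ r)⁻¹ * x) ≤ 1 := by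
    rw [map_mul, map_inv₀, map_zpow₀, inv_mul_le_iff₀ (zpow_pos h0 r), mul_one]
    exact hx.trans ((zpow_le_zpow_iff_right_of_lt_one₀ h0 h1).2 hr)
  have key' (x : F) (m r : ℤ) (hx : valuation F x ≤ valuation F (ϖ : F) ^ m) (hr : r < m) :
      valuation F (((ϖ : F) ^ r)⁻¹ * x) < 1 := by
    rw [map_mul, map_inv₀, map_zpow₀, inv_mul_lt_iff₀ (zpow_pos h0 r), mul_one]
    exact hx.trans_lt ((zpow_lt_zpow_iff_right_of_lt_one₀ h0 h1).2 hr)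
  have hdet : g.1.det = g.1 0 0 * g.1 1 1 - g.1 0 1 * g.1 1 0 := Matrix.det_fin_two _
  obtain ⟨r, hr⟩ := Int.even_or_odd' n
  have hϖr : (ϖ : F) ^ r ≠ 0 := zpow_ne_zero _ hϖ0
  refine ⟨GeneralLinearGroup.scalar (Fin 2) (Units.mk0 _ hϖr), scalar_mem_center _, ?_⟩
  rcases hr with hr | hr
  · let A : Matrix (Fin 2) (Fin 2) F := !![((ϖ : F) ^ r)⁻¹ * g.1 0 0, ((ϖ : F) ^ r)⁻¹ * g.1 0 1;
      ((ϖ : F) ^ r)⁻¹ * g.1 1 0, ((ϖ : F) ^ r)⁻¹ * g.1 1 1]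
    have hA : A.det = ((ϖ : F) ^ r * (ϖ : F) ^ r)⁻¹ * g.1.det := by
      rw [hdet]; simp only [A, Matrix.det_fin_two_of, mul_inv]; ring
    refine ⟨GeneralLinearGroup.mkOfDetNeZero A (by rw [hA]; positivity), ?_, Or.inl ?_⟩
    · refine ⟨mem_maxCompact.2 ⟨?_, ?_⟩, ?_⟩
      · simp only [Fin.forall_fin_two]
        exact ⟨⟨key _ r r (ha r (by omega)) le_rfl, key _ r r (hb r (by omega)) le_rfl⟩,
          ⟨key _ r r (hc r (by omega)) le_rfl, key _ r r (hd r (by omega)) le_rfl⟩⟩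
      · change valuation F A.det = 1
        rw [hA, map_mul, hn, map_inv₀, map_mul, map_zpow₀, ← zpow_add₀ h0.ne', hr, two_mul,
          inv_mul_cancel₀ (zpow_ne_zero _ h0.ne')]
      · exact key' _ (r + 1) r (hc (r + 1) (by omega)) (by omega)
    · apply GeneralLinearGroup.ext
      intro i j
      fin_cases i <;> fin_cases j <;>
        simp [A, hϖr]
  · let A : Matrix (Fin 2) (Fin 2) F :=
      !![((ϖ : F) ^ (r + 1))⁻¹ * g.1 1 0, ((ϖ : F) ^ (r + 1))⁻¹ * g.1 1 1;
        ((ϖ : F) ^ r)⁻¹ * g.1 0 0, ((ϖ : F) ^ r)⁻¹ * g.1 0 1]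
    have hA : A.det = -(((ϖ : F) ^ (r + 1) * (ϖ : F) ^ r)⁻¹ * g.1.det) := by
      rw [hdet]; simp only [A, Matrix.det_fin_two_of, mul_inv]; ring
    refine ⟨GeneralLinearGroup.mkOfDetNeZero A (by
      rw [hA, neg_ne_zero]
      exact mul_ne_zero (inv_ne_zero (mul_ne_zero (zpow_ne_zero _ hϖ0) hϖr)) hΔ), ?_, Or.inr ?_⟩
    · refine ⟨mem_maxCompact.2 ⟨?_, ?_⟩, ?_⟩
      · simp only [Fin.forall_fin_two]
        exact ⟨⟨key _ (r + 1) (r + 1) (hc _ (by omega)) le_rfl,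
            key _ (r + 1) (r + 1) (hd _ (by omega)) le_rfl⟩,
          ⟨key _ r r (ha r (by omega)) le_rfl, key _ r r (hb r (by omega)) le_rfl⟩⟩
      · change valuation F A.det = 1
        rw [hA, Valuation.map_neg, map_mul, hn, map_inv₀, map_mul, map_zpow₀, map_zpow₀,
          ← zpow_add₀ h0.ne', hr, show r + 1 + r = 2 * r + 1 by ring,
          inv_mul_cancel₀ (zpow_ne_zero _ h0.ne')]
      · exact key' _ (r + 1) r (ha (r + 1) (by omega)) (by omega)
    · have e : (ϖ : F) ^ (r + 1) = ϖ ^ r * ϖ := zpow_add_one₀ hϖ0 r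
      apply GeneralLinearGroup.ext
      intro i j
      fin_cases i <;> fin_cases j <;>
        simp [A, PiMat, Matrix.mul_apply, Fin.sum_univ_two, e] <;>
        field_simp

/-- `I P⁺ ⊆ P⁺ K`. -/
theorem iwahori_mul_Pplus {h x : GL (Fin 2) F} (hh : h ∈ iwahori F) (hx : x ∈ Pplus F) :
    ∃ y ∈ Pplus F, ∃ k ∈ maxCompact F, h * x = y * k := by
  obtain ⟨hK, hc⟩ := hh
  obtain ⟨hK, hdet⟩ := mem_maxCompact.1 hK
  obtain ⟨hx0, hx1, hx2, hx3⟩ := hx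
  have hD : h.1.det = h.1 0 0 * h.1 1 1 - h.1 0 1 * h.1 1 0 := Matrix.det_fin_two _
  have hxD : x.1.det = x.1 0 0 := by rw [Matrix.det_fin_two, hx2, hx3]; ring
  have hx00 : x.1 0 0 ≠ 0 := hxD ▸ GeneralLinearGroup.det_ne_zero x
  have hD0 : h.1.det ≠ 0 := GeneralLinearGroup.det_ne_zero h
  set e : F := h.1 1 0 * x.1 0 1 + h.1 1 1 with he
  have hcy : valuation F (h.1 1 0 * x.1 0 1) < 1 := by
    rw [map_mul]; exact (mul_le_of_le_one_right' hx1).trans_lt hc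
  have hd : valuation F (h.1 1 1) = 1 := by
    refine le_antisymm (hK 1 1) (not_lt.1 fun hlt => ?_)
    refine hdet.not_lt ?_
    rw [hD]
    apply Valuation.map_sub_lt
    · rw [map_mul]; exact (mul_le_of_le_one_left' (hK 0 0)).trans_lt hlt
    · rw [map_mul]; exact (mul_le_of_le_one_left' (hK 0 1)).trans_lt hc
  have hve : valuation F e = 1 := by
    rw [he, Valuation.map_add_eq_of_lt_right _ (by rw [hd]; exact hcy), hd]
  have he0 : e ≠ 0 := by
    rintro h0; rw [h0, map_zero] at hve; exact zero_ne_one hve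
  let y : GL (Fin 2) F := GeneralLinearGroup.mkOfDetNeZero
    !![x.1 0 0 * h.1.det / e ^ 2, (h.1 0 0 * x.1 0 1 + h.1 0 1) / e; 0, 1] (by
      rw [Matrix.det_fin_two_of, mul_one, mul_zero, sub_zero]
      exact div_ne_zero (mul_ne_zero hx00 hD0) (pow_ne_zero _ he0))
  let k : GL (Fin 2) F := GeneralLinearGroup.mkOfDetNeZero
    !![e, 0; h.1 1 0 * x.1 0 0, e] (by simp [Matrix.det_fin_two, he0])
  have hy : y.1 = !![x.1 0 0 * h.1.det / e ^ 2, (h.1 0 0 * x.1 0 1 + h.1 0 1) / e; 0, 1] := rfl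
  have hk : k.1 = !![e, 0; h.1 1 0 * x.1 0 0, e] := rfl
  refine ⟨y, ⟨?_, ?_, ?_, ?_⟩, k, mem_maxCompact.2 ⟨?_, ?_⟩, ?_⟩
  · rw [hy]
    change valuation F (x.1 0 0 * h.1.det / e ^ 2) ≤ 1
    rw [map_div₀, map_mul, map_pow, hve, hdet]
    simpa using (show valuation F (x.1 0 0) ≤ 1 from hx0)
  · rw [hy]
    change valuation F ((h.1 0 0 * x.1 0 1 + h.1 0 1) / e) ≤ 1
    rw [map_div₀, hve, div_one]
    refine Valuation.map_add_le _ ?_ (hK 0 1)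
    rw [map_mul]
    exact mul_le_one' (hK 0 0) hx1
  · rw [hy]; rfl
  · rw [hy]; rfl
  · rw [hk]
    simp only [Fin.forall_fin_two]
    refine ⟨⟨hve.le, ?_⟩, ?_, hve.le⟩
    · change valuation F 0 ≤ 1
      simp
    · change valuation F (h.1 1 0 * x.1 0 0) ≤ 1
      rw [map_mul]
      exact mul_le_one' (hK 1 0) hx0
  · rw [hk, Matrix.det_fin_two_of, zero_mul, sub_zero, map_mul, hve, one_mul]
  · apply GeneralLinearGroup.ext
    intro i j
    rw [GeneralLinearGroup.coe_mul, GeneralLinearGroup.coe_mul, Matrix.mul_apply,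
      Matrix.mul_apply, Fin.sum_univ_two, Fin.sum_univ_two, hy, hk]
    fin_cases i <;> fin_cases j <;>
      simp only [Fin.zero_eta, Fin.mk_one, Matrix.of_apply, Matrix.cons_val, hx2, hx3]
    · rw [hD]
      field_simp
      rw [he]
      ring
    · field_simp
      ring
    · ring
    · rw [he]
      ring

theorem PiMat_mul_self_mem_center {ϖ : 𝒪[F]} (hϖ : Irreducible ϖ) :
    PiMat ϖ hϖ * PiMat ϖ hϖ ∈ Subgroup.center (GL (Fin 2) F) := by
  have hϖ0 : (ϖ : F) ≠ 0 := by simpa using hϖ.ne_zero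
  have : PiMat ϖ hϖ * PiMat ϖ hϖ = GeneralLinearGroup.scalar (Fin 2) (Units.mk0 _ hϖ0) := by
    apply GeneralLinearGroup.ext
    intro i j
    fin_cases i <;> fin_cases j <;>
      simp [PiMat, Matrix.mul_apply, Fin.sum_univ_two]
  rw [this]
  exact scalar_mem_center _

/-- `Π` normalizes `I`. -/
theorem PiMat_mem_N {ϖ : 𝒪[F]} (hϖ : Irreducible ϖ) : PiMat ϖ hϖ ∈ N F := by
  have h0 : 0 < valuation F (ϖ : F) := Valuation.integer.v_irreducible_pos hϖ
  have h1 : valuation F (ϖ : F) < 1 := Valuation.integer.v_irreducible_lt_one hϖ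
  have hϖ0 : (ϖ : F) ≠ 0 := by simpa using hϖ.ne_zero
  have key : ∀ h ∈ iwahori F, PiMat ϖ hϖ * h * (PiMat ϖ hϖ)⁻¹ ∈ iwahori F := by
    rintro h ⟨hK, hc⟩
    obtain ⟨hK, hdet⟩ := mem_maxCompact.1 hK
    have hD : h.1.det = h.1 0 0 * h.1 1 1 - h.1 0 1 * h.1 1 0 := Matrix.det_fin_two _
    let A : Matrix (Fin 2) (Fin 2) F :=
      !![h.1 1 1, (ϖ : F)⁻¹ * h.1 1 0; (ϖ : F) * h.1 0 1, h.1 0 0]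
    have hA : A.det = h.1.det := by
      rw [hD, Matrix.det_fin_two_of]; field_simp
    have e : PiMat ϖ hϖ * h * (PiMat ϖ hϖ)⁻¹ = GeneralLinearGroup.mkOfDetNeZero A
        (hA ▸ GeneralLinearGroup.det_ne_zero h) := by
      rw [mul_inv_eq_iff_eq_mul]
      apply GeneralLinearGroup.ext
      intro i j
      fin_cases i <;> fin_cases j <;>
        simp [A, PiMat, Matrix.mul_apply, Fin.sum_univ_two, hϖ0, mul_comm]
    rw [e]
    refine ⟨mem_maxCompact.2 ⟨?_, ?_⟩, ?_⟩
    · simp only [Fin.forall_fin_two]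
      refine ⟨⟨hK 1 1, ?_⟩, ?_, hK 0 0⟩
      · change valuation F ((ϖ : F)⁻¹ * h.1 1 0) ≤ 1
        rw [map_mul, map_inv₀, inv_mul_le_iff₀ h0, mul_one]
        simpa using valuation_le_zpow hϖ (s := 0) (t := 0) (m := 1)
          (by simpa using pow_lt_one₀ zero_le hc two_ne_zero) (by norm_num)
      · change valuation F ((ϖ : F) * h.1 0 1) ≤ 1
        rw [map_mul]
        exact mul_le_one' h1.le (hK 0 1)
    · exact (congrArg _ hA).trans hdet
    · change valuation F ((ϖ : F) * h.1 0 1) < 1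
      rw [map_mul]
      exact (mul_le_of_le_one_right' (hK 0 1)).trans_lt h1
  intro h
  refine ⟨key h, fun hh => ?_⟩
  have h2 := key _ hh
  have hz := Subgroup.mem_center_iff.1 (PiMat_mul_self_mem_center hϖ) h
  have e : PiMat ϖ hϖ * (PiMat ϖ hϖ * h * (PiMat ϖ hϖ)⁻¹) * (PiMat ϖ hϖ)⁻¹ = h := by
    rw [mul_inv_eq_iff_eq_mul, ← mul_assoc, mul_inv_eq_iff_eq_mul, ← mul_assoc, ← hz, mul_assoc]
  rwa [e] at h2

end NormalizerOfIwahori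
section Representations

variable {k H V : Type*} [Field k] [Group H] [AddCommGroup V] [Module k V]

/-- A representation of a topological group is smooth if every vector is fixed by an open
subgroup. -/
def IsSmooth [TopologicalSpace H] (ρ : Representation k H V) : Prop :=
  ∀ v : V, ∃ U : Subgroup H, IsOpen (U : Set H) ∧ ∀ g ∈ U, ρ g v = v

/-- The centre of the group acts through a character. -/
def HasCentralCharacter (ρ : Representation k H V) : Prop :=
  ∃ χ : Subgroup.center H →* kˣ, ∀ (z : Subgroup.center H) (v : V), ρ z v = (χ z : k) • v

/-- The restriction of a representation to a subgroup. -/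
def res (ρ : Representation k H V) (S : Subgroup H) : Representation k S V :=
  ρ.comp S.subtype

theorem IsSmooth.res [TopologicalSpace H] {ρ : Representation k H V} (hρ : IsSmooth ρ)
    (S : Subgroup H) : IsSmooth (res ρ S) := fun v => by
  obtain ⟨U, hU, h⟩ := hρ v
  exact ⟨U.comap S.subtype, hU.preimage continuous_subtype_val, fun g hg => h g hg⟩

theorem IsSmooth.toRepresentation [TopologicalSpace H] {ρ : Representation k H V}
    (hρ : IsSmooth ρ) (W : Subrepresentation ρ) : IsSmooth W.toRepresentation := fun v => by
  obtain ⟨U, hU, h⟩ := hρ v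
  exact ⟨U, hU, fun g hg => Subtype.ext (h g hg)⟩

end Representations

section Diagrams

universe u v w

/-- A diagram `(D₀, D₁, r)`: a smooth representation `D₀` of `KZ`, a smooth representation `D₁`
of `N` and an `IZ`-equivariant linear map `r : D₁ → D₀`. -/
structure Diagram (F : Type u) [Field F] [ValuativeRel F] [TopologicalSpace F]
    (k : Type v) [Field k] where
  V₀ : Type w
  V₁ : Type w
  [addCommGroup₀ : AddCommGroup V₀]
  [module₀ : Module k V₀]
  [addCommGroup₁ : AddCommGroup V₁]
  [module₁ : Module k V₁]
  D₀ : Representation k (KZ F) V₀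
  D₁ : Representation k (N F) V₁
  smooth₀ : IsSmooth D₀
  smooth₁ : IsSmooth D₁
  r : V₁ →ₗ[k] V₀
  equivariant : ∀ (g : GL (Fin 2) F) (hg : g ∈ IZ F) (x : V₁),
    r (D₁ ⟨g, IZ_le_N hg⟩ x) = D₀ ⟨g, IZ_le_KZ hg⟩ (r x)

attribute [instance] Diagram.addCommGroup₀ Diagram.module₀ Diagram.addCommGroup₁ Diagram.module₁

/-- A smooth representation of `G = GL₂(F)`. -/
structure SmoothRep (F : Type u) [Field F] [TopologicalSpace F] (k : Type v) [Field k] where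
  V : Type w
  [addCommGroup : AddCommGroup V]
  [module : Module k V]
  ρ : Representation k (GL (Fin 2) F) V
  smooth : IsSmooth ρ

attribute [instance] SmoothRep.addCommGroup SmoothRep.module

variable {F : Type u} [Field F] [ValuativeRel F] [TopologicalSpace F] {k : Type v} [Field k]

namespace Diagram

universe w₁ w₂ w₃

/-- The `k`-vector space of morphisms of diagrams: pairs of a `KZ`-equivariant map `φ₀` and an
`N`-equivariant map `φ₁` such that `φ₀ ∘ r = r' ∘ φ₁`. -/
def Hom (D : Diagram.{u, v, w₁} F k) (D' : Diagram.{u, v, w₂} F k) :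
    Submodule k (D.D₀.IntertwiningMap D'.D₀ × D.D₁.IntertwiningMap D'.D₁) where
  carrier := {φ | ∀ x : D.V₁, φ.1 (D.r x) = D'.r (φ.2 x)}
  add_mem' := by
    intro a b ha hb x
    simp [ha x, hb x]
  zero_mem' := by
    intro x
    simp
  smul_mem' := by
    intro c a ha x
    simp [ha x]

/-- Composition of morphisms of diagrams. -/
def comp {D : Diagram.{u, v, w₁} F k} {D' : Diagram.{u, v, w₂} F k} {D'' : Diagram.{u, v, w₃} F k}
    (ψ : Hom D' D'') (φ : Hom D D') : Hom D D'' :=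
  ⟨(ψ.1.1.comp φ.1.1, ψ.1.2.comp φ.1.2), fun x => by
    simp [φ.2 x, ψ.2 (φ.1.2 x)]⟩

/-- The diagram `𝒦(π) = (π|_{KZ}, π|_N, can)` of a smooth representation `π` of `G`. -/
def calK (π : SmoothRep.{u, v, w} F k) : Diagram.{u, v, w} F k where
  V₀ := π.V
  V₁ := π.V
  D₀ := res π.ρ (KZ F)
  D₁ := res π.ρ (N F)
  smooth₀ := π.smooth.res _
  smooth₁ := π.smooth.res _
  r := LinearMap.id
  equivariant := fun _ _ _ => rfl

/-- The morphism of diagrams `𝒦(φ) : 𝒦(π) → 𝒦(π')` of a `G`-equivariant map `φ : π → π'`. -/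
def calK.map {π : SmoothRep.{u, v, w₁} F k} {π' : SmoothRep.{u, v, w₂} F k}
    (φ : π.ρ.IntertwiningMap π'.ρ) : Hom (calK π) (calK π') :=
  ⟨(⟨φ.toLinearMap, fun g => φ.isIntertwining' g⟩, ⟨φ.toLinearMap, fun g => φ.isIntertwining' g⟩),
    fun _ => rfl⟩

/-- The subdiagram `(W₀, W₁, can)` of `𝒦(π)` given by a subrepresentation `W₀` of `π|_{KZ}` and a
subrepresentation `W₁` of `π|_N` with `W₁ ⊆ W₀`. -/
def sub (π : SmoothRep.{u, v, w} F k) (W₀ : Subrepresentation (res π.ρ (KZ F)))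
    (W₁ : Subrepresentation (res π.ρ (N F))) (h : W₁.toSubmodule ≤ W₀.toSubmodule) :
    Diagram.{u, v, w} F k where
  V₀ := W₀.toSubmodule
  V₁ := W₁.toSubmodule
  D₀ := W₀.toRepresentation
  D₁ := W₁.toRepresentation
  smooth₀ := (π.smooth.res _).toRepresentation _
  smooth₁ := (π.smooth.res _).toRepresentation _
  r := Submodule.inclusion h
  equivariant := fun _ _ _ => rfl

/-- The inclusion of a subdiagram of `𝒦(π)` into `𝒦(π)`. -/
def sub.incl (π : SmoothRep.{u, v, w} F k) (W₀ : Subrepresentation (res π.ρ (KZ F)))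
    (W₁ : Subrepresentation (res π.ρ (N F))) (h : W₁.toSubmodule ≤ W₀.toSubmodule) :
    Hom (sub π W₀ W₁ h) (calK π) :=
  ⟨(⟨W₀.toSubmodule.subtype, fun _ => rfl⟩, ⟨W₁.toSubmodule.subtype, fun _ => rfl⟩), fun _ => rfl⟩

end Diagram

end Diagrams

section Canonical

universe u v w

variable {F : Type u} [Field F] [ValuativeRel F] [TopologicalSpace F]
  {k : Type v} [Field k] (ϖ : 𝒪[F]) (hϖ : Irreducible ϖ) (π : SmoothRep.{u, v, w} F k)
  (σ : Subrepresentation (res π.ρ (KZ F)))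

/-- `I⁺(σ, π) = ⟨P⁺ · σ⟩`. -/
def Iplus : Submodule k π.V :=
  Submodule.span k {x | ∃ g ∈ Pplus F, ∃ v ∈ σ, π.ρ g v = x}

/-- `I⁻(σ, π) = Π · I⁺(σ, π)`. -/
def Iminus : Submodule k π.V :=
  (Iplus π σ).map (π.ρ (PiMat ϖ hϖ))

variable [IsNonarchimedeanLocalField F]

theorem center_Iplus {z : GL (Fin 2) F} (hz : z ∈ Subgroup.center (GL (Fin 2) F)) {x : π.V}
    (hx : x ∈ Iplus π σ) : π.ρ z x ∈ Iplus π σ := by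
  refine (Submodule.span_le (p := (Iplus π σ).comap (π.ρ z))).2 ?_ hx
  rintro _ ⟨g, hg, v, hv, rfl⟩
  refine Submodule.subset_span ⟨g, hg, π.ρ z v, ?_, ?_⟩
  · exact σ.apply_mem_toSubmodule ⟨z, Subgroup.mem_sup_right hz⟩ hv
  · rw [← Module.End.mul_apply, ← Module.End.mul_apply, ← map_mul, ← map_mul,
      Subgroup.mem_center_iff.1 hz g]

theorem iwahori_Iplus {h : GL (Fin 2) F} (hh : h ∈ iwahori F) {x : π.V}
    (hx : x ∈ Iplus π σ) : π.ρ h x ∈ Iplus π σ := by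
  refine (Submodule.span_le (p := (Iplus π σ).comap (π.ρ h))).2 ?_ hx
  rintro _ ⟨g, hg, v, hv, rfl⟩
  obtain ⟨y, hy, c, hc, e⟩ := iwahori_mul_Pplus hh hg
  refine Submodule.subset_span ⟨y, hy, π.ρ c v, ?_, ?_⟩
  · exact σ.apply_mem_toSubmodule ⟨c, Subgroup.mem_sup_left hc⟩ hv
  · rw [← Module.End.mul_apply, ← Module.End.mul_apply, ← map_mul, ← map_mul, e]

theorem PiMat_Iminus {x : π.V} (hx : x ∈ Iminus ϖ hϖ π σ) :
    π.ρ (PiMat ϖ hϖ) x ∈ Iplus π σ := by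
  obtain ⟨y, hy, rfl⟩ := hx
  rw [← Module.End.mul_apply, ← map_mul]
  exact center_Iplus π σ (PiMat_mul_self_mem_center hϖ) hy

theorem center_Iminus {z : GL (Fin 2) F} (hz : z ∈ Subgroup.center (GL (Fin 2) F)) {x : π.V}
    (hx : x ∈ Iminus ϖ hϖ π σ) : π.ρ z x ∈ Iminus ϖ hϖ π σ := by
  obtain ⟨y, hy, rfl⟩ := hx
  refine ⟨π.ρ z y, center_Iplus π σ hz hy, ?_⟩
  rw [← Module.End.mul_apply, ← Module.End.mul_apply, ← map_mul, ← map_mul,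
    Subgroup.mem_center_iff.1 hz]

theorem iwahori_Iminus {h : GL (Fin 2) F} (hh : h ∈ iwahori F) {x : π.V}
    (hx : x ∈ Iminus ϖ hϖ π σ) : π.ρ h x ∈ Iminus ϖ hϖ π σ := by
  obtain ⟨y, hy, rfl⟩ := hx
  have h' : (PiMat ϖ hϖ)⁻¹ * h * PiMat ϖ hϖ ∈ iwahori F := by
    have := ((inv_mem (PiMat_mem_N hϖ) : (PiMat ϖ hϖ)⁻¹ ∈ N F) h).1 hh
    rwa [inv_inv] at this
  refine ⟨_, iwahori_Iplus π σ h' hy, ?_⟩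
  rw [← Module.End.mul_apply, ← Module.End.mul_apply, ← map_mul, ← map_mul]
  congr 2
  group

/-- `D₁(π) = I⁺(σ, π) ∩ I⁻(σ, π)`, a subrepresentation of `π|_N`. -/
def D₁ : Subrepresentation (res π.ρ (N F)) where
  toSubmodule := Iplus π σ ⊓ Iminus ϖ hϖ π σ
  apply_mem_toSubmodule := by
    rintro ⟨g, hg⟩ x ⟨hx, hx'⟩
    change π.ρ g x ∈ _
    obtain ⟨z, hz, h, hh, rfl | rfl⟩ := exists_of_mem_N hϖ hg
    · rw [map_mul, Module.End.mul_apply]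
      exact ⟨center_Iplus π σ hz (iwahori_Iplus π σ hh hx),
        center_Iminus ϖ hϖ π σ hz (iwahori_Iminus ϖ hϖ π σ hh hx')⟩
    · rw [map_mul, map_mul, Module.End.mul_apply, Module.End.mul_apply]
      exact ⟨center_Iplus π σ hz (PiMat_Iminus ϖ hϖ π σ (iwahori_Iminus ϖ hϖ π σ hh hx')),
        center_Iminus ϖ hϖ π σ hz ⟨_, iwahori_Iplus π σ hh hx, rfl⟩⟩

/-- `D₀(π) = ⟨K · D₁(π)⟩`, a subrepresentation of `π|_{KZ}`. -/
def D₀ : Subrepresentation (res π.ρ (KZ F)) where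
  toSubmodule := Submodule.span k {x | ∃ g ∈ maxCompact F, ∃ v ∈ D₁ ϖ hϖ π σ, π.ρ g v = x}
  apply_mem_toSubmodule := by
    rintro ⟨g, hg⟩ x hx
    refine (Submodule.span_le (p := (Submodule.span k
      {x | ∃ g ∈ maxCompact F, ∃ v ∈ D₁ ϖ hϖ π σ, π.ρ g v = x}).comap (π.ρ g))).2 ?_ hx
    rintro _ ⟨c, hc, v, hv, rfl⟩
    obtain ⟨a, ha, z, hz, rfl⟩ := Subgroup.mem_sup_of_normal_right.1 hg
    refine Submodule.subset_span ⟨a * c, mul_mem ha hc, π.ρ z v, ?_, ?_⟩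
    · exact (D₁ ϖ hϖ π σ).apply_mem_toSubmodule ⟨z, center_le_N hz⟩ hv
    · rw [← Module.End.mul_apply, ← Module.End.mul_apply, ← map_mul, ← map_mul, mul_assoc,
        mul_assoc, Subgroup.mem_center_iff.1 hz c]

theorem D₁_le_D₀ : (D₁ ϖ hϖ π σ).toSubmodule ≤ (D₀ ϖ hϖ π σ).toSubmodule := fun v hv =>
  Submodule.subset_span ⟨1, one_mem _, v, hv, by simp⟩

/-- The canonical diagram `D(π) = (D₀(π), D₁(π), can)`, computed from the irreducible
subrepresentation `σ` of `π|_{KZ}`. -/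
def canonicalDiagram : Diagram.{u, v, w} F k :=
  Diagram.sub π (D₀ ϖ hϖ π σ) (D₁ ϖ hϖ π σ) (D₁_le_D₀ ϖ hϖ π σ)

/-- The inclusion `D(π) → 𝒦(π)`. -/
def canonicalDiagram.incl : Diagram.Hom (canonicalDiagram ϖ hϖ π σ) (Diagram.calK π) :=
  Diagram.sub.incl π (D₀ ϖ hϖ π σ) (D₁ ϖ hϖ π σ) (D₁_le_D₀ ϖ hϖ π σ)

end Canonical

end CanonicalDiagram

end

/-!
The translates of a `KZ`-subrepresentation `τ` of `π` live on the vertices `G/KZ` of the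
Bruhat–Tits tree, and `Π` exchanges the two half-trees at the standard edge. If `τ ⊆ I⁺(π)`, then
reordering a relation `∑ π(gᵢ) wᵢ = 0` by the distance of its vertices from a base point moves its
outermost terms into `I⁺ ∩ I⁻` of an edge. Hence a family of linear maps `θ g : τ → X` defines a
map on the span of the `G`-translates of `τ` as soon as it is compatible along edges.

For `τ = D₀(π)` this extends a morphism of diagrams `D(π) → 𝒦(π')` to `π → π'`, uniquely since
`D₀(π) ≠ 0` generates `π`. It remains to see that `D₁(π) ≠ 0`. Otherwise the edge condition for
`τ = σ` is void, so every family on `G/KZ` extends to `π`. On the one hand the spheres of the tree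
then give infinitely many independent vectors fixed by the first congruence subgroup of `K`; on the
other hand `π` has a nonzero functional invariant under the mirabolic subgroup, and by the Iwasawa
decomposition its `K`-translates separate these vectors, which therefore span a finite dimensional
space.
-/

namespace CanonicalDiagram

open ValuativeRel Matrix

section EntryNorm

variable {R Γ₀ l m n : Type*} [CommRing R] [LinearOrderedCommGroupWithZero Γ₀] (v : Valuation R Γ₀)
  [Fintype l] [Fintype m] [Fintype n]

/-- The largest valuation of an entry of `A`. For `R = F` it is the norm defined by the standard
lattice, which is invariant under `K` on both sides. -/
def entryNorm (A : Matrix m n R) : Γ₀ :=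
  Finset.univ.sup fun x : m × n => v (A x.1 x.2)

variable {v}

theorem entryNorm_le_iff {A : Matrix m n R} {γ : Γ₀} :
    entryNorm v A ≤ γ ↔ ∀ i j, v (A i j) ≤ γ := by
  simp [entryNorm]

variable (v) in
theorem le_entryNorm (A : Matrix m n R) (i : m) (j : n) : v (A i j) ≤ entryNorm v A :=
  entryNorm_le_iff.1 le_rfl i j

variable (v) in
theorem exists_eq_entryNorm [Nonempty m] [Nonempty n] (A : Matrix m n R) :
    ∃ i j, v (A i j) = entryNorm v A := by
  obtain ⟨x, -, hx⟩ :=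
    Finset.exists_mem_eq_sup Finset.univ Finset.univ_nonempty fun x : m × n => v (A x.1 x.2)
  exact ⟨x.1, x.2, hx.symm⟩

theorem entryNorm_mul_le (A : Matrix l m R) (B : Matrix m n R) :
    entryNorm v (A * B) ≤ entryNorm v A * entryNorm v B := by
  refine entryNorm_le_iff.2 fun i j => ?_
  rw [Matrix.mul_apply]
  refine v.map_sum_le fun t _ => ?_
  rw [map_mul]
  exact mul_le_mul' (le_entryNorm v A i t) (le_entryNorm v B t j)

theorem entryNorm_smul [Nonempty m] [Nonempty n] (a : R) (A : Matrix m n R) :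
    entryNorm v (a • A) = v a * entryNorm v A := by
  refine le_antisymm (entryNorm_le_iff.2 fun i j => ?_) ?_
  · rw [Matrix.smul_apply, smul_eq_mul, map_mul]
    exact mul_le_mul_right (le_entryNorm v A i j) _
  · obtain ⟨i, j, hij⟩ := exists_eq_entryNorm v A
    rw [← hij, ← map_mul]
    exact le_entryNorm v (a • A) i j

theorem valuation_det_le [DecidableEq n] (A : Matrix n n R) :
    v A.det ≤ entryNorm v A ^ Fintype.card n := by
  rw [Matrix.det_apply']
  refine v.map_sum_le fun s _ => ?_
  have hsign : v ((Equiv.Perm.sign s : ℤ) : R) = 1 := by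
    rcases Int.units_eq_one_or (Equiv.Perm.sign s) with h | h <;> simp [h]
  rw [map_mul, hsign, one_mul, map_prod]
  exact Finset.prod_le_pow_card _ _ _ fun i _ => le_entryNorm v A _ _

end EntryNorm

section Cosets

theorem exists_ne_zero_row {F : Type*} [Field F] {n : Type*} [Fintype n] [DecidableEq n]
    (g : GL n F) (i : n) : ∃ j, g.1 i j ≠ 0 := by
  by_contra! h
  exact GeneralLinearGroup.det_ne_zero g (Matrix.det_eq_zero_of_row_eq_zero i h)

variable {F : Type*} [Field F] [ValuativeRel F]

theorem mem_maxCompact_iff {g : GL (Fin 2) F} :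
    g ∈ maxCompact F ↔ entryNorm (valuation F) g.1 ≤ 1 ∧ valuation F g.1.det = 1 := by
  rw [entryNorm_le_iff, mem_maxCompact]

theorem exists_mem_maxCompact_coe_eq {A : Matrix (Fin 2) (Fin 2) F}
    (hA : ∀ i j, valuation F (A i j) ≤ 1) (hdet : valuation F A.det = 1) :
    ∃ c ∈ maxCompact F, c.1 = A := by
  have hdet0 : A.det ≠ 0 := fun h => by simp [h] at hdet
  exact ⟨GeneralLinearGroup.mkOfDetNeZero A hdet0, mem_maxCompact.2 ⟨hA, hdet⟩, rfl⟩

theorem entryNorm_mul_maxCompact {c : GL (Fin 2) F} (hc : c ∈ maxCompact F)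
    (A : Matrix (Fin 2) (Fin 2) F) :
    entryNorm (valuation F) (A * c.1) = entryNorm (valuation F) A := by
  have mul_le {c : GL (Fin 2) F} (hc : c ∈ maxCompact F) (A : Matrix (Fin 2) (Fin 2) F) :
      entryNorm (valuation F) (A * c.1) ≤ entryNorm (valuation F) A :=
    (entryNorm_mul_le _ _).trans (mul_le_of_le_one_right' (mem_maxCompact_iff.1 hc).1)
  refine (mul_le hc A).antisymm ?_
  simpa using mul_le (inv_mem hc) (A * c.1)

theorem entryNorm_maxCompact_mul {c : GL (Fin 2) F} (hc : c ∈ maxCompact F)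
    (A : Matrix (Fin 2) (Fin 2) F) :
    entryNorm (valuation F) (c.1 * A) = entryNorm (valuation F) A := by
  have mul_le {c : GL (Fin 2) F} (hc : c ∈ maxCompact F) (A : Matrix (Fin 2) (Fin 2) F) :
      entryNorm (valuation F) (c.1 * A) ≤ entryNorm (valuation F) A :=
    (entryNorm_mul_le _ _).trans (mul_le_of_le_one_left' (mem_maxCompact_iff.1 hc).1)
  refine (mul_le hc A).antisymm ?_
  simpa using mul_le (inv_mem hc) (c.1 * A)

theorem entryNorm_of_mem_maxCompact {c : GL (Fin 2) F} (hc : c ∈ maxCompact F) :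
    entryNorm (valuation F) c.1 = 1 := by
  refine (mem_maxCompact_iff.1 hc).1.antisymm ?_
  rw [← entryNorm_mul_maxCompact (inv_mem hc), ← GeneralLinearGroup.coe_mul, mul_inv_cancel]
  simpa using le_entryNorm (valuation F) (1 : Matrix (Fin 2) (Fin 2) F) 0 0

theorem exists_mem_KZ_coe_eq_smul {c : GL (Fin 2) F} (hc : c ∈ maxCompact F) {a : F} (ha : a ≠ 0) :
    ∃ h ∈ KZ F, h.1 = a • c.1 := by
  refine ⟨c * GeneralLinearGroup.scalar (Fin 2) (Units.mk0 a ha),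
    mul_mem (Subgroup.mem_sup_left hc) (Subgroup.mem_sup_right
      (GeneralLinearGroup.mem_center_iff_val_mem_range_scalar.2 ⟨a, rfl⟩)), ?_⟩
  change c.1 * Matrix.scalar (Fin 2) a = _
  rw [Matrix.scalar_apply, ← Matrix.smul_one_eq_diagonal, Matrix.mul_smul, Matrix.mul_one]

theorem exists_coe_eq_smul_of_mem_KZ {h : GL (Fin 2) F} (hh : h ∈ KZ F) :
    ∃ c ∈ maxCompact F, ∃ a : F, h.1 = a • c.1 := by
  obtain ⟨c, hc, z, hz, rfl⟩ := Subgroup.mem_sup_of_normal_right.1 hh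
  obtain ⟨a, ha⟩ := GeneralLinearGroup.mem_center_iff_val_mem_range_scalar.1 hz
  refine ⟨c, hc, a, ?_⟩
  rw [GeneralLinearGroup.coe_mul, ← ha, Matrix.scalar_apply, ← Matrix.smul_one_eq_diagonal,
    Matrix.mul_smul, Matrix.mul_one]

theorem entryNorm_mul_KZ {h : GL (Fin 2) F} (hh : h ∈ KZ F) (A : Matrix (Fin 2) (Fin 2) F) :
    entryNorm (valuation F) (A * h.1) =
      entryNorm (valuation F) A * entryNorm (valuation F) h.1 := by
  obtain ⟨c, hc, a, e⟩ := exists_coe_eq_smul_of_mem_KZ hh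
  rw [e, Matrix.mul_smul, entryNorm_smul, entryNorm_smul, entryNorm_mul_maxCompact hc,
    entryNorm_of_mem_maxCompact hc, mul_one, mul_comm]

theorem entryNorm_KZ_mul {h : GL (Fin 2) F} (hh : h ∈ KZ F) (A : Matrix (Fin 2) (Fin 2) F) :
    entryNorm (valuation F) (h.1 * A) =
      entryNorm (valuation F) h.1 * entryNorm (valuation F) A := by
  obtain ⟨c, hc, a, e⟩ := exists_coe_eq_smul_of_mem_KZ hh
  rw [e, Matrix.smul_mul, entryNorm_smul, entryNorm_smul, entryNorm_maxCompact_mul hc,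
    entryNorm_of_mem_maxCompact hc, mul_one]

theorem mem_KZ_iff {g : GL (Fin 2) F} :
    g ∈ KZ F ↔ valuation F g.1.det = entryNorm (valuation F) g.1 ^ 2 := by
  constructor
  · intro hg
    obtain ⟨c, hc, a, e⟩ := exists_coe_eq_smul_of_mem_KZ hg
    rw [e, entryNorm_smul, entryNorm_of_mem_maxCompact hc, Matrix.det_smul, map_mul, map_pow,
      (mem_maxCompact.1 hc).2, mul_one, mul_one, Fintype.card_fin]
  · intro hdet
    obtain ⟨i, j, hij⟩ := exists_eq_entryNorm (valuation F) g.1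
    have hm : g.1 i j ≠ 0 := by
      intro h0
      rw [← hij, h0, map_zero, zero_pow two_ne_zero, map_eq_zero] at hdet
      exact GeneralLinearGroup.det_ne_zero g hdet
    have hvm : valuation F (g.1 i j) ≠ 0 := by rwa [ne_eq, map_eq_zero]
    obtain ⟨c, hc, e⟩ := exists_mem_maxCompact_coe_eq (A := (g.1 i j)⁻¹ • g.1)
      (entryNorm_le_iff.1 (by rw [entryNorm_smul, ← hij, map_inv₀, inv_mul_cancel₀ hvm])) (by
        rw [Matrix.det_smul, map_mul, hdet, ← hij, Fintype.card_fin, map_pow, map_inv₀, ← mul_pow,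
          inv_mul_cancel₀ hvm, one_pow])
    obtain ⟨h, hh, e'⟩ := exists_mem_KZ_coe_eq_smul hc hm
    rw [e, smul_inv_smul₀ hm] at e'
    rwa [← Units.ext e']

theorem exists_mul_apply_zero_eq_zero (A : Matrix (Fin 2) (Fin 2) F) (i : Fin 2) :
    ∃ c ∈ maxCompact F, (A * c.1) i 0 = 0 := by
  have div_le_one {x y : F} (h : valuation F x ≤ valuation F y) : valuation F (x / y) ≤ 1 := by
    rw [map_div₀]
    exact div_le_one_of_le₀ h zero_le
  rcases le_total (valuation F (A i 1)) (valuation F (A i 0)) with hle | hle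
  · obtain ⟨c, hc, e⟩ := exists_mem_maxCompact_coe_eq (A := !![-(A i 1 / A i 0), 1; 1, 0])
      (by simpa [Fin.forall_fin_two] using div_le_one hle) (by simp)
    have hdiv : A i 0 * (A i 1 / A i 0) = A i 1 :=
      mul_div_cancel_of_imp' fun h0 => by simpa [h0] using hle
    exact ⟨c, hc, by simp [e, Matrix.mul_apply, hdiv]⟩
  · obtain ⟨c, hc, e⟩ := exists_mem_maxCompact_coe_eq (A := !![1, 0; -(A i 0 / A i 1), 1])
      (by simpa [Fin.forall_fin_two] using div_le_one hle) (by simp)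
    have hdiv : A i 1 * (A i 0 / A i 1) = A i 0 :=
      mul_div_cancel_of_imp' fun h0 => by simpa [h0] using hle
    exact ⟨c, hc, by simp [e, Matrix.mul_apply, hdiv]⟩

theorem exists_mem_KZ_mul_apply_eq (g : GL (Fin 2) F) (i : Fin 2) :
    ∃ h ∈ KZ F, (g * h).1 i 0 = 0 ∧ (g * h).1 i 1 = 1 := by
  obtain ⟨c, hc, h0⟩ := exists_mul_apply_zero_eq_zero g.1 i
  have hm : (g.1 * c.1) i 1 ≠ 0 := by
    obtain ⟨j, hj⟩ := exists_ne_zero_row (g * c) i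
    obtain rfl | rfl := Fin.exists_fin_two.1 ⟨j, rfl⟩
    · exact absurd h0 hj
    · exact hj
  obtain ⟨h, hh, e⟩ := exists_mem_KZ_coe_eq_smul hc (inv_ne_zero hm)
  refine ⟨h, hh, ?_, ?_⟩ <;>
    rw [GeneralLinearGroup.coe_mul, e, Matrix.mul_smul, Matrix.smul_apply, smul_eq_mul]
  · rw [h0, mul_zero]
  · exact inv_mul_cancel₀ hm

/-- A normal form for the representatives of the cosets in `G/KZ`: the matrix is integral and its
`i`-th row is `(0 1)`. For `i = 1` these are the elements of `P⁺`. -/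
structure IsNormalForm (i : Fin 2) (g : GL (Fin 2) F) : Prop where
  entryNorm_le : entryNorm (valuation F) g.1 ≤ 1
  apply_zero : g.1 i 0 = 0
  apply_one : g.1 i 1 = 1

theorem mem_Pplus_iff {g : GL (Fin 2) F} : g ∈ Pplus F ↔ IsNormalForm 1 g := by
  constructor
  · rintro ⟨h00, h01, h10, h11⟩
    refine ⟨entryNorm_le_iff.2 ?_, h10, h11⟩
    have h : valuation F (g.1 0 0) ≤ 1 ∧ valuation F (g.1 0 1) ≤ 1 := ⟨h00, h01⟩
    simpa [Fin.forall_fin_two, h10, h11] using h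
  · rintro ⟨hle, h10, h11⟩
    exact ⟨entryNorm_le_iff.1 hle 0 0, entryNorm_le_iff.1 hle 0 1, h10, h11⟩

theorem exists_mem_Pplus_coe_eq {a b : F} (ha0 : a ≠ 0) (ha : valuation F a ≤ 1)
    (hb : valuation F b ≤ 1) : ∃ x ∈ Pplus F, x.1 = !![a, b; 0, 1] :=
  ⟨GeneralLinearGroup.mkOfDetNeZero !![a, b; 0, 1] (by simpa using ha0), ⟨ha, hb, rfl, rfl⟩, rfl⟩

namespace IsNormalForm

variable {i : Fin 2} {g : GL (Fin 2) F} (hg : IsNormalForm i g)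
include hg

theorem entryNorm_eq_one : entryNorm (valuation F) g.1 = 1 := by
  refine hg.entryNorm_le.antisymm ?_
  simpa [hg.apply_one] using le_entryNorm (valuation F) g.1 i 1

theorem mul_Pplus {x : GL (Fin 2) F} (hx : x ∈ Pplus F) : IsNormalForm i (g * x) := by
  refine ⟨(entryNorm_mul_le _ _).trans
    (mul_le_one' hg.entryNorm_le (mem_Pplus_iff.1 hx).entryNorm_le), ?_, ?_⟩ <;>
  simp [Matrix.mul_apply, hg.apply_zero, hg.apply_one, hx.2.2.1, hx.2.2.2]

theorem valuation_apply_zero_le (a : Fin 2) :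
    valuation F (g.1 a 0) ≤ valuation F g.1.det := by
  have h0 := hg.apply_zero
  have h1 := hg.apply_one
  rw [Matrix.det_fin_two]
  fin_cases i <;> fin_cases a <;> simp_all

end IsNormalForm

theorem exists_isNormalForm_of_entryNorm_le {g : GL (Fin 2) F} {i j : Fin 2}
    (hij : entryNorm (valuation F) g.1 ≤ valuation F (g.1 i j)) :
    ∃ h ∈ KZ F, IsNormalForm i (g * h) := by
  obtain ⟨h, hh, h0, h1⟩ := exists_mem_KZ_mul_apply_eq g i
  refine ⟨h, hh, ?_, h0, h1⟩
  have hrow : g.1 i j = (h⁻¹).1 1 j := by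
    rw [← mul_inv_cancel_right g h, GeneralLinearGroup.coe_mul, Matrix.mul_apply,
      Fin.sum_univ_two, h0, h1, zero_mul, one_mul, zero_add]
  calc entryNorm (valuation F) (g * h).1
      = entryNorm (valuation F) g.1 * entryNorm (valuation F) h.1 := entryNorm_mul_KZ hh g.1
    _ ≤ entryNorm (valuation F) (h⁻¹).1 * entryNorm (valuation F) h.1 :=
        mul_le_mul_left (hij.trans (hrow ▸ le_entryNorm _ _ _ _)) _
    _ = entryNorm (valuation F) (h⁻¹ * h).1 := (entryNorm_mul_KZ hh _).symm
    _ = 1 := by rw [inv_mul_cancel]; exact entryNorm_of_mem_maxCompact (one_mem _)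

theorem exists_isNormalForm (g : GL (Fin 2) F) : ∃ h ∈ KZ F, ∃ i, IsNormalForm i (g * h) := by
  obtain ⟨i, j, hij⟩ := exists_eq_entryNorm (valuation F) g.1
  obtain ⟨h, hh, hn⟩ := exists_isNormalForm_of_entryNorm_le hij.ge
  exact ⟨h, hh, i, hn⟩

end Cosets

section PiMat

variable {F : Type*} [Field F] [ValuativeRel F] {ϖ : 𝒪[F]} (hϖ : Irreducible ϖ)

theorem mul_PiMat_apply_zero (g : GL (Fin 2) F) (i : Fin 2) :
    (g * PiMat ϖ hϖ).1 i 0 = ϖ * g.1 i 1 := by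
  simp [PiMat, Matrix.mul_apply, mul_comm]

theorem mul_PiMat_apply_one (g : GL (Fin 2) F) (i : Fin 2) :
    (g * PiMat ϖ hϖ).1 i 1 = g.1 i 0 := by
  simp [PiMat, Matrix.mul_apply]

theorem PiMat_mul_apply_zero (g : GL (Fin 2) F) (j : Fin 2) :
    (PiMat ϖ hϖ * g).1 0 j = g.1 1 j := by
  simp [PiMat, Matrix.mul_apply]

theorem PiMat_mul_apply_one (g : GL (Fin 2) F) (j : Fin 2) :
    (PiMat ϖ hϖ * g).1 1 j = ϖ * g.1 0 j := by
  simp [PiMat, Matrix.mul_apply]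

theorem exists_iwahori_mul_apply_eq {g : GL (Fin 2) F} {i : Fin 2}
    (h0 : valuation F (g.1 i 0) < 1) (h1 : valuation F (g.1 i 1) = 1) :
    ∃ h ∈ iwahori F, (g * h).1 i 0 = 0 ∧ (g * h).1 i 1 = 1 := by
  have hne : g.1 i 1 ≠ 0 := fun h => by simp [h] at h1
  have hdiv : valuation F (g.1 i 0 / g.1 i 1) < 1 := by rwa [map_div₀, h1, div_one]
  obtain ⟨h, hh, e⟩ := exists_mem_maxCompact_coe_eq
    (A := !![1, 0; -(g.1 i 0 / g.1 i 1), (g.1 i 1)⁻¹])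
    (by simpa [Fin.forall_fin_two, h1] using hdiv.le) (by simp [h1])
  refine ⟨h, ⟨hh, by simpa [e] using hdiv⟩, ?_, ?_⟩
  · simp [e, Matrix.mul_apply, mul_div_cancel₀ _ hne]
  · simp [e, Matrix.mul_apply, hne]

theorem exists_iwahori_mul_PiMat_mul_mem_Pplus {c : GL (Fin 2) F} (hc : c ∈ maxCompact F)
    (hcI : c ∉ iwahori F) : ∃ h ∈ iwahori F, c * PiMat ϖ hϖ * h ∈ Pplus F := by
  have hϖ1 : valuation F (ϖ : F) < 1 := Valuation.integer.v_irreducible_lt_one hϖ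
  have hint (i j : Fin 2) : valuation F (c.1 i j) ≤ 1 := (mem_maxCompact.1 hc).1 i j
  have hlt : valuation F ((c * PiMat ϖ hϖ).1 1 0) < 1 := by
    rw [mul_PiMat_apply_zero, map_mul]
    exact mul_lt_one_of_lt_of_le hϖ1 (hint 1 1)
  have heq : valuation F ((c * PiMat ϖ hϖ).1 1 1) = 1 := by
    rw [mul_PiMat_apply_one]
    exact (hint 1 0).eq_of_not_lt fun h => hcI ⟨hc, h⟩
  obtain ⟨h, hh, h0, h1⟩ := exists_iwahori_mul_apply_eq hlt heq
  refine ⟨h, hh, mem_Pplus_iff.2 ⟨?_, h0, h1⟩⟩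
  rw [GeneralLinearGroup.coe_mul, entryNorm_mul_maxCompact (iwahori_le_maxCompact hh),
    GeneralLinearGroup.coe_mul, entryNorm_maxCompact_mul hc]
  simpa [entryNorm_le_iff, Fin.forall_fin_two, PiMat] using hϖ1.le

end PiMat

section Tree

variable {F : Type*} [Field F] [ValuativeRel F]

/-- The distance between the vertices `KZ` and `gKZ` of the Bruhat–Tits tree `G/KZ`, read off the
determinant of the multiple of `g` with largest entry of valuation `1`. -/
noncomputable def level (ϖ : 𝒪[F]) (g : GL (Fin 2) F) : ℕ :=
  sInf {n | valuation F g.1.det = valuation F (ϖ : F) ^ n * entryNorm (valuation F) g.1 ^ 2}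

theorem entryNorm_pos (g : GL (Fin 2) F) : 0 < entryNorm (valuation F) g.1 := by
  obtain ⟨j, hj⟩ := exists_ne_zero_row g 0
  exact (zero_lt_iff.2 (by rwa [ne_eq, map_eq_zero])).trans_le (le_entryNorm (valuation F) g.1 0 j)

theorem level_eq {ϖ : 𝒪[F]} (hϖ : Irreducible ϖ) {g : GL (Fin 2) F} {n : ℕ}
    (hn : valuation F g.1.det = valuation F (ϖ : F) ^ n * entryNorm (valuation F) g.1 ^ 2) :
    level ϖ g = n := by
  suffices {n | valuation F g.1.det =
      valuation F (ϖ : F) ^ n * entryNorm (valuation F) g.1 ^ 2} = {n} by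
    rw [level, this, csInf_singleton]
  refine Set.eq_singleton_iff_unique_mem.2 ⟨hn, fun m hm => ?_⟩
  have hm' := mul_right_cancel₀ (pow_ne_zero 2 (entryNorm_pos g).ne') (hm.symm.trans hn)
  exact pow_right_injective₀ (Valuation.integer.v_irreducible_pos hϖ)
    (Valuation.integer.v_irreducible_lt_one hϖ).ne hm'

theorem exists_level_eq {ϖ : 𝒪[F]} (hϖ : Irreducible ϖ) (n : ℕ) :
    ∃ g : GL (Fin 2) F, level ϖ g = n := by
  have hϖ0 : (ϖ : F) ≠ 0 := by simpa using hϖ.ne_zero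
  obtain ⟨x, hx, e⟩ := exists_mem_Pplus_coe_eq (b := 0) (pow_ne_zero n hϖ0)
    (by rw [map_pow]; exact pow_le_one₀ zero_le ϖ.2) (by simp)
  refine ⟨x, level_eq hϖ ?_⟩
  rw [(mem_Pplus_iff.1 hx).entryNorm_eq_one, e]
  simp

variable [TopologicalSpace F] [IsNonarchimedeanLocalField F] {ϖ : 𝒪[F]} (hϖ : Irreducible ϖ)
include hϖ

theorem valuation_le_uniformizer {x : F} (hx : valuation F x < 1) :
    valuation F x ≤ valuation F (ϖ : F) := by
  simpa using valuation_le_zpow hϖ (s := 0) (t := 0) (m := 1)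
    (by simpa using pow_lt_one₀ zero_le hx two_ne_zero) (by norm_num)

theorem exists_valuation_eq_pow {x : F} (hx : x ≠ 0) (hx1 : valuation F x ≤ 1) :
    ∃ n : ℕ, valuation F x = valuation F (ϖ : F) ^ n := by
  obtain ⟨n, hn⟩ := exists_valuation_eq_zpow hϖ hx
  have hnonneg : 0 ≤ n := by
    rwa [← zpow_le_zpow_iff_right_of_lt_one₀ (Valuation.integer.v_irreducible_pos hϖ)
      (Valuation.integer.v_irreducible_lt_one hϖ), ← hn, zpow_zero]
  lift n to ℕ using hnonneg
  exact ⟨n, by simpa using hn⟩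

theorem valuation_det_eq (g : GL (Fin 2) F) :
    valuation F g.1.det = valuation F (ϖ : F) ^ level ϖ g * entryNorm (valuation F) g.1 ^ 2 := by
  obtain ⟨i, j, hij⟩ := exists_eq_entryNorm (valuation F) g.1
  have hpos : 0 < entryNorm (valuation F) g.1 ^ 2 := pow_pos (entryNorm_pos g) 2
  have hdiv : valuation F (g.1.det / g.1 i j ^ 2) =
      valuation F g.1.det / entryNorm (valuation F) g.1 ^ 2 := by rw [map_div₀, map_pow, hij]
  obtain ⟨n, hn⟩ := exists_valuation_eq_pow hϖ (x := g.1.det / g.1 i j ^ 2)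
    (by
      rw [← (valuation F).ne_zero_iff, hdiv]
      exact div_ne_zero ((valuation F).ne_zero_iff.2 (GeneralLinearGroup.det_ne_zero g)) hpos.ne')
    (by
      rw [hdiv]
      exact div_le_one_of_le₀ (by simpa using valuation_det_le (v := valuation F) g.1) zero_le)
  rw [hdiv, div_eq_iff hpos.ne'] at hn
  rwa [level_eq hϖ hn]

theorem level_mul_right (g : GL (Fin 2) F) {h : GL (Fin 2) F} (hh : h ∈ KZ F) :
    level ϖ (g * h) = level ϖ g := by
  refine level_eq hϖ ?_
  rw [GeneralLinearGroup.coe_mul, Matrix.det_mul, map_mul, valuation_det_eq hϖ g,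
    mem_KZ_iff.1 hh, entryNorm_mul_KZ hh, mul_pow, mul_assoc]

theorem level_mul_left (g : GL (Fin 2) F) {h : GL (Fin 2) F} (hh : h ∈ KZ F) :
    level ϖ (h * g) = level ϖ g := by
  refine level_eq hϖ ?_
  rw [GeneralLinearGroup.coe_mul, Matrix.det_mul, map_mul, valuation_det_eq hϖ g,
    mem_KZ_iff.1 hh, entryNorm_KZ_mul hh, mul_pow, mul_left_comm]

theorem mem_KZ_of_level_eq_zero {g : GL (Fin 2) F} (hg : level ϖ g = 0) : g ∈ KZ F := by
  rw [mem_KZ_iff, valuation_det_eq hϖ, hg, pow_zero, one_mul]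

theorem IsNormalForm.valuation_det {i : Fin 2} {g : GL (Fin 2) F} (hg : IsNormalForm i g) :
    valuation F g.1.det = valuation F (ϖ : F) ^ level ϖ g := by
  rw [valuation_det_eq hϖ, hg.entryNorm_eq_one, one_pow, mul_one]

-- `PiMat ϖ hϖ` flips an edge of the tree, which divides the vertices into two halves.
theorem exists_mul_mem_Pplus_or (g : GL (Fin 2) F) :
    ∃ h ∈ KZ F, g * h ∈ Pplus F ∨ (PiMat ϖ hϖ)⁻¹ * (g * h) ∈ Pplus F := by
  obtain ⟨h, hh, i, hn⟩ := exists_isNormalForm g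
  obtain rfl | rfl : i = 1 ∨ i = 0 := (Fin.exists_fin_two.1 ⟨i, rfl⟩).symm
  · exact ⟨h, hh, Or.inl (mem_Pplus_iff.2 hn)⟩
  by_cases hrow : ∃ j, valuation F ((g * h).1 1 j) = 1
  · obtain ⟨j, hj⟩ := hrow
    obtain ⟨h', hh', hn'⟩ := exists_isNormalForm_of_entryNorm_le (hn.entryNorm_le.trans hj.ge)
    exact ⟨h * h', mul_mem hh hh', Or.inl (mem_Pplus_iff.2 (by rwa [← mul_assoc]))⟩
  push Not at hrow
  refine ⟨h, hh, Or.inr ?_⟩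
  obtain ⟨y, e⟩ : ∃ y, g * h = PiMat ϖ hϖ * y := ⟨_, (mul_inv_cancel_left _ _).symm⟩
  rw [e] at hn hrow ⊢
  rw [inv_mul_cancel_left]
  have hint (j : Fin 2) : valuation F (y.1 0 j) ≤ 1 := by
    have hle := valuation_le_uniformizer hϖ
      ((entryNorm_le_iff.1 hn.entryNorm_le 1 j).lt_of_ne (hrow j))
    rw [PiMat_mul_apply_one, map_mul] at hle
    exact (mul_le_iff_le_one_right (Valuation.integer.v_irreducible_pos hϖ)).1 hle
  exact ⟨hint 0, hint 1, by rw [← PiMat_mul_apply_zero hϖ, hn.apply_zero],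
    by rw [← PiMat_mul_apply_zero hϖ, hn.apply_one]⟩

theorem IsNormalForm.level_mul_PiMat_lt {i : Fin 2} {g : GL (Fin 2) F} (hg : IsNormalForm i g)
    (hpos : level ϖ g ≠ 0) : level ϖ (g * PiMat ϖ hϖ) < level ϖ g := by
  have hϖ1 : valuation F (ϖ : F) < 1 := Valuation.integer.v_irreducible_lt_one hϖ
  obtain ⟨n, hn⟩ := Nat.exists_eq_succ_of_ne_zero hpos
  have hdet := hg.valuation_det hϖ
  have hcol (a : Fin 2) : valuation F (g.1 a 0) ≤ valuation F (ϖ : F) := by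
    refine (hg.valuation_apply_zero_le a).trans ?_
    rw [hdet]
    exact pow_le_of_le_one zero_le hϖ1.le hpos
  have hnorm : entryNorm (valuation F) (g * PiMat ϖ hϖ).1 = valuation F (ϖ : F) := by
    refine le_antisymm (entryNorm_le_iff.2 fun a => Fin.forall_fin_two.2 ⟨?_, ?_⟩) ?_
    · rw [mul_PiMat_apply_zero, map_mul]
      exact mul_le_of_le_one_right' (entryNorm_le_iff.1 hg.entryNorm_le a 1)
    · rw [mul_PiMat_apply_one]
      exact hcol a
    · simpa [mul_PiMat_apply_zero, hg.apply_one] using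
        le_entryNorm (valuation F) (g * PiMat ϖ hϖ).1 i 0
  have hdetPi : valuation F (PiMat ϖ hϖ).1.det = valuation F (ϖ : F) := by simp [PiMat]
  have hlevel : level ϖ (g * PiMat ϖ hϖ) = n := level_eq hϖ (by
    rw [hnorm, GeneralLinearGroup.coe_mul, Matrix.det_mul, map_mul, hdet, hdetPi, hn, ← pow_succ,
      ← pow_add])
  omega

-- Seen from a vertex at distance `n` from `KZ`, every vertex at distance at most `n` from `KZ` lies
-- in the direction of `KZ`.
theorem IsNormalForm.mem_or_of_level_le {i : Fin 2} {g y : GL (Fin 2) F} (hg : IsNormalForm i g)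
    (hy : level ϖ y ≤ level ϖ g) :
    g⁻¹ * y ∈ KZ F ∨ ∃ h ∈ KZ F, (g * PiMat ϖ hϖ)⁻¹ * (y * h) ∈ Pplus F := by
  obtain ⟨h, hh, hx | hx⟩ := exists_mul_mem_Pplus_or hϖ (g⁻¹ * y)
  · refine Or.inl ((Subgroup.mul_mem_cancel_right _ hh).1 ?_)
    set x := g⁻¹ * y * h with hxdef
    have hgx : level ϖ (g * x) ≤ level ϖ g := by
      rwa [hxdef, mul_assoc, mul_inv_cancel_left, level_mul_right hϖ y hh]
    have hnorm := (mem_Pplus_iff.1 hx).entryNorm_eq_one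
    rw [mem_KZ_iff, hnorm, one_pow]
    refine le_antisymm (by simpa [hnorm] using valuation_det_le (v := valuation F) x.1) ?_
    have hle : valuation F g.1.det ≤ valuation F (g * x).1.det := by
      rw [hg.valuation_det hϖ, (hg.mul_Pplus hx).valuation_det hϖ]
      exact pow_le_pow_of_le_one zero_le ϖ.2 hgx
    have hdet : 0 < valuation F g.1.det :=
      zero_lt_iff.2 ((valuation F).ne_zero_iff.2 (GeneralLinearGroup.det_ne_zero g))
    rw [GeneralLinearGroup.coe_mul, Matrix.det_mul, map_mul] at hle
    exact (le_mul_iff_one_le_right hdet).1 hle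
  · refine Or.inr ⟨h, hh, ?_⟩
    rwa [_root_.mul_inv_rev, mul_assoc, ← mul_assoc g⁻¹]

end Tree

section OrbitSpan

variable {k H V : Type*} [Field k] [Group H] [AddCommGroup V] [Module k V]

/-- The subrepresentation generated by a set of vectors. -/
def orbitSpan (ρ : Representation k H V) (S : Set V) : Subrepresentation ρ where
  toSubmodule := Submodule.span k {x | ∃ g, ∃ v ∈ S, ρ g v = x}
  apply_mem_toSubmodule := by
    intro h x hx
    refine (Submodule.span_le (p := (Submodule.span k _).comap (ρ h))).2 ?_ hx
    rintro _ ⟨g, v, hv, rfl⟩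
    exact Submodule.subset_span ⟨h * g, v, hv, by rw [map_mul, Module.End.mul_apply]⟩

theorem apply_mem_orbitSpan (ρ : Representation k H V) {S : Set V} {v : V} (hv : v ∈ S) (g : H) :
    ρ g v ∈ orbitSpan ρ S :=
  Submodule.subset_span ⟨g, v, hv, rfl⟩

theorem mem_orbitSpan (ρ : Representation k H V) {S : Set V} {v : V} (hv : v ∈ S) :
    v ∈ orbitSpan ρ S := by
  simpa using apply_mem_orbitSpan ρ hv 1

theorem orbitSpan_eq_top {ρ : Representation k H V} [ρ.IsIrreducible] {S : Set V} {v : V}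
    (hv : v ∈ S) (hv0 : v ≠ 0) : orbitSpan ρ S = ⊤ := by
  refine (eq_bot_or_eq_top _).resolve_left fun h => hv0 ?_
  have hmem := mem_orbitSpan ρ hv
  rw [h] at hmem
  exact (Submodule.mem_bot k).1 hmem

theorem orbitSpan_toSubmodule_eq_top {ρ : Representation k H V} [ρ.IsIrreducible] {U : Subgroup H}
    {τ : Subrepresentation (res ρ U)} (hτ : τ ≠ ⊥) :
    orbitSpan ρ (τ.toSubmodule : Set V) = ⊤ := by
  obtain ⟨x, hx, hx0⟩ := Submodule.exists_mem_ne_zero_of_ne_bot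
    (Subrepresentation.toSubmodule_injective.ne hτ)
  exact orbitSpan_eq_top hx hx0

theorem linearMap_ext_of_orbitSpan_eq_top {X : Type*} [AddCommGroup X] [Module k X]
    {ρ : Representation k H V} {S : Set V} (hS : orbitSpan ρ S = ⊤) {f f' : V →ₗ[k] X}
    (h : ∀ g, ∀ v ∈ S, f (ρ g v) = f' (ρ g v)) : f = f' := by
  refine LinearMap.ext_on (congrArg Subrepresentation.toSubmodule hS) ?_
  rintro _ ⟨g, v, hv, rfl⟩
  exact h g v hv

end OrbitSpan

section HalfTree

universe u v w

variable {F : Type u} [Field F] [ValuativeRel F] [TopologicalSpace F]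
  {k : Type v} [Field k] (π : SmoothRep.{u, v, w} F k) (σ : Subrepresentation (res π.ρ (KZ F)))

theorem Pplus_Iplus {y : GL (Fin 2) F} (hy : y ∈ Pplus F) {x : π.V} (hx : x ∈ Iplus π σ) :
    π.ρ y x ∈ Iplus π σ := by
  refine (Submodule.span_le (p := (Iplus π σ).comap (π.ρ y))).2 ?_ hx
  rintro _ ⟨g, hg, v, hv, rfl⟩
  exact Submodule.subset_span ⟨y * g, mul_mem hy hg, v, hv, by rw [map_mul, Module.End.mul_apply]⟩

theorem le_Iplus : σ.toSubmodule ≤ Iplus π σ := fun v hv =>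
  Submodule.subset_span ⟨1, one_mem _, v, hv, by simp⟩

theorem D₀_le_Iplus [IsNonarchimedeanLocalField F] (ϖ : 𝒪[F]) (hϖ : Irreducible ϖ) :
    (D₀ ϖ hϖ π σ).toSubmodule ≤ Iplus π σ := by
  refine Submodule.span_le.2 ?_
  rintro _ ⟨c, hc, v, hv, rfl⟩
  by_cases hcI : c ∈ iwahori F
  · exact iwahori_Iplus π σ hcI hv.1
  · obtain ⟨h, hh, hx⟩ := exists_iwahori_mul_PiMat_mul_mem_Pplus hϖ hc hcI
    have hPi : π.ρ (PiMat ϖ hϖ)⁻¹ v ∈ D₁ ϖ hϖ π σ :=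
      (D₁ ϖ hϖ π σ).apply_mem_toSubmodule ⟨_, inv_mem (PiMat_mem_N hϖ)⟩ hv
    have e : π.ρ c v =
        π.ρ (c * PiMat ϖ hϖ * h) (π.ρ h⁻¹ (π.ρ (PiMat ϖ hϖ)⁻¹ v)) := by
      rw [← Module.End.mul_apply, ← map_mul, ← Module.End.mul_apply, ← map_mul]
      group
    rw [e]
    exact Pplus_Iplus π σ hx (iwahori_Iplus π σ (inv_mem hh) hPi.1)

end HalfTree

section Gluing

variable {R M V ι : Type*} [Ring R] [AddCommGroup M] [AddCommGroup V] [Module R M] [Module R V]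
  {E : ι → Submodule R M} {f : M →ₗ[R] V} {level : ι → ℕ}

theorem mem_iSup_level_lt_of_map_eq_zero
    (hstep : ∀ x, ∀ u ∈ E x, ∀ b ∈ ⨆ y, ⨆ (_ : E y ≠ E x ∧ level y ≤ level x), E y,
      f (u + b) = 0 → u ∈ ⨆ y, ⨆ (_ : level y < level x), E y)
    {n : ℕ} {z : M} (hz : z ∈ ⨆ y, ⨆ (_ : level y ≤ n), E y) (hfz : f z = 0) :
    z ∈ ⨆ y, ⨆ (_ : level y < n), E y := by
  classical
  obtain ⟨a, ha, rfl⟩ := (Submodule.mem_iSup_iff_exists_finsupp _ z).1 hz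
  have haE (i : ι) : a i ∈ E i := (iSup_const_le : _ ≤ E i) (ha i)
  have hlevel {i : ι} (hi : i ∈ a.support) : level i ≤ n := by
    by_contra h
    exact Finsupp.mem_support_iff.1 hi (by simpa [h] using ha i)
  rw [Finsupp.sum, ← Finset.sum_fiberwise_of_maps_to fun i hi => Finset.mem_image_of_mem E hi]
  refine sum_mem fun W _ => ?_
  by_cases hW : ∃ x ∈ a.support, E x = W ∧ level x = n
  · obtain ⟨x, -, rfl, rfl⟩ := hW
    refine hstep x _ (sum_mem fun i hi => (Finset.mem_filter.1 hi).2 ▸ haE i)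
      (∑ i ∈ a.support with ¬E i = E x, a i) (sum_mem fun i hi => ?_) ?_
    · obtain ⟨hi, hne⟩ := Finset.mem_filter.1 hi
      exact Submodule.mem_iSup_of_mem i (Submodule.mem_iSup_of_mem ⟨hne, hlevel hi⟩ (haE i))
    · rwa [Finset.sum_filter_add_sum_filter_not]
  · push Not at hW
    refine sum_mem fun i hi => ?_
    obtain ⟨hi, hiW⟩ := Finset.mem_filter.1 hi
    exact Submodule.mem_iSup_of_mem i (Submodule.mem_iSup_of_mem
      ((hlevel hi).lt_of_ne (hW i hi hiW)) (haE i))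

theorem disjoint_iSup_ker_of_level
    (hstep : ∀ x, ∀ u ∈ E x, ∀ b ∈ ⨆ y, ⨆ (_ : E y ≠ E x ∧ level y ≤ level x), E y,
      f (u + b) = 0 → u ∈ ⨆ y, ⨆ (_ : level y < level x), E y) :
    Disjoint (⨆ x, E x) (LinearMap.ker f) := by
  have eq_zero (n : ℕ) : ∀ z ∈ ⨆ y, ⨆ (_ : level y < n), E y, f z = 0 → z = 0 := by
    induction n with
    | zero => simp
    | succ n ih =>
      intro z hz hfz
      simp only [Nat.lt_succ_iff] at hz
      exact ih z (mem_iSup_level_lt_of_map_eq_zero hstep hz hfz) hfz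
  refine Submodule.disjoint_def.2 fun z hz hfz => ?_
  obtain ⟨s, hs⟩ := Submodule.mem_iSup_iff_exists_finset.1 hz
  refine eq_zero (s.sup level + 1) z ?_ hfz
  have hle : ⨆ x ∈ s, E x ≤ ⨆ x, ⨆ (_ : level x < s.sup level + 1), E x :=
    iSup_mono fun x => iSup_mono' fun hx => ⟨Nat.lt_succ_of_le (Finset.le_sup hx), le_rfl⟩
  exact hle hs

end Gluing

section LocalGraph

universe u v w w'

variable {F : Type u} [Field F] [ValuativeRel F] [TopologicalSpace F] {k : Type v} [Field k]
  {π : SmoothRep.{u, v, w} F k} {τ : Subrepresentation (res π.ρ (KZ F))}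
  {X : Type w'} [AddCommGroup X] [Module k X]

/-- The graph of the map `π(g) w ↦ θ g w` on the translate `π(g) τ`. -/
def localGraph (θ : GL (Fin 2) F → τ.toSubmodule →ₗ[k] X) (g : GL (Fin 2) F) :
    Submodule k (π.V × X) :=
  LinearMap.range ((π.ρ g ∘ₗ τ.toSubmodule.subtype).prod (θ g))

/-- The maps `π(g) w ↦ θ g w` on the translates `π(g) τ` depend only on the vertex `gKZ` of the tree
and agree along the edge from `gKZ` to `gΠKZ`, on the translate by `g` of `τ ∩ I⁻(σ, π)`. -/
structure IsLocallyCompatible (ϖ : 𝒪[F]) (hϖ : Irreducible ϖ)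
    (σ : Subrepresentation (res π.ρ (KZ F))) (θ : GL (Fin 2) F → τ.toSubmodule →ₗ[k] X) : Prop where
  mul_mem_KZ (g : GL (Fin 2) F) (h : KZ F) (w : τ.toSubmodule) :
    θ (g * h) w = θ g (τ.toRepresentation h w)
  mul_PiMat (g : GL (Fin 2) F) (w : τ.toSubmodule) (hw : (w : π.V) ∈ Iminus ϖ hϖ π σ) :
    ∃ w' : τ.toSubmodule, π.ρ (PiMat ϖ hϖ) w' = w ∧ θ (g * PiMat ϖ hϖ) w' = θ g w

namespace IsLocallyCompatible

variable {ϖ : 𝒪[F]} {hϖ : Irreducible ϖ} {σ : Subrepresentation (res π.ρ (KZ F))}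
  {θ : GL (Fin 2) F → τ.toSubmodule →ₗ[k] X} (hθ : IsLocallyCompatible ϖ hϖ σ θ)
include hθ

theorem localGraph_mul (g : GL (Fin 2) F) {h : GL (Fin 2) F} (hh : h ∈ KZ F) :
    localGraph θ (g * h) = localGraph θ g := by
  have mul_le (g : GL (Fin 2) F) {h : GL (Fin 2) F} (hh : h ∈ KZ F) :
      localGraph θ (g * h) ≤ localGraph θ g := by
    rintro _ ⟨w, rfl⟩
    refine ⟨τ.toRepresentation ⟨h, hh⟩ w, Prod.ext ?_ (hθ.mul_mem_KZ g ⟨h, hh⟩ w).symm⟩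
    change π.ρ g (π.ρ h w) = π.ρ (g * h) w
    rw [map_mul, Module.End.mul_apply]
  refine (mul_le g hh).antisymm ?_
  simpa using mul_le (g * h) (inv_mem hh)

theorem localGraph_eq_of_inv_mul_mem {g h : GL (Fin 2) F} (hgh : g⁻¹ * h ∈ KZ F) :
    localGraph θ h = localGraph θ g := by
  simpa using hθ.localGraph_mul g hgh

theorem mem_localGraph_mul_PiMat (g : GL (Fin 2) F) {w : τ.toSubmodule}
    (hw : (w : π.V) ∈ Iminus ϖ hϖ π σ) :
    (π.ρ g w, θ g w) ∈ localGraph θ (g * PiMat ϖ hϖ) := by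
  obtain ⟨w', e, e'⟩ := hθ.mul_PiMat g w hw
  refine ⟨w', Prod.ext ?_ e'⟩
  change π.ρ (g * PiMat ϖ hϖ) w' = π.ρ g w
  rw [map_mul, Module.End.mul_apply, e]

variable [IsNonarchimedeanLocalField F] (hτ : τ.toSubmodule ≤ Iplus π σ)
include hτ

theorem fst_mem_map_Iminus {i : Fin 2} {g : GL (Fin 2) F} (hg : IsNormalForm i g) {b : π.V × X}
    (hb : b ∈ ⨆ y, ⨆ (_ : localGraph θ y ≠ localGraph θ g ∧ level ϖ y ≤ level ϖ g),
      localGraph θ y) :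
    b.1 ∈ (Iminus ϖ hϖ π σ).map (π.ρ g) := by
  refine (iSup₂_le fun y hy => ?_ : _ ≤
    ((Iminus ϖ hϖ π σ).map (π.ρ g)).comap (LinearMap.fst k π.V X)) hb
  rcases hg.mem_or_of_level_le hϖ hy.2 with hmem | ⟨h, hh, hx⟩
  · exact absurd (hθ.localGraph_eq_of_inv_mul_mem hmem) hy.1
  rintro _ ⟨v, rfl⟩
  have hv : π.ρ h⁻¹ v ∈ Iplus π σ := hτ (τ.apply_mem_toSubmodule ⟨h⁻¹, inv_mem hh⟩ v.2)
  refine ⟨_, ⟨_, Pplus_Iplus π σ hx hv, rfl⟩, ?_⟩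
  change π.ρ g (π.ρ (PiMat ϖ hϖ) _) = π.ρ y v
  simp only [← Module.End.mul_apply, ← map_mul]
  group

theorem mem_iSup_localGraph_level_lt (x : GL (Fin 2) F) {u : π.V × X} (hu : u ∈ localGraph θ x)
    {b : π.V × X} (hb : b ∈ ⨆ y, ⨆ (_ : localGraph θ y ≠ localGraph θ x ∧ level ϖ y ≤ level ϖ x),
      localGraph θ y) (hub : (u + b).1 = 0) :
    u ∈ ⨆ y, ⨆ (_ : level ϖ y < level ϖ x), localGraph θ y := by
  obtain ⟨h, hh, i, hg⟩ := exists_isNormalForm x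
  rw [← level_mul_right hϖ x hh] at hb ⊢
  rw [← hθ.localGraph_mul x hh] at hu hb
  obtain ⟨w, rfl⟩ := hu
  set g := x * h
  have hsum : π.ρ g w + b.1 = 0 := hub
  by_cases hlevel : level ϖ g = 0
  · have hb0 : b = 0 := by
      suffices ∀ y, ¬(localGraph θ y ≠ localGraph θ g ∧ level ϖ y ≤ level ϖ g) by
        simpa [this] using hb
      rintro y ⟨hne, hle⟩
      exact hne (hθ.localGraph_eq_of_inv_mul_mem (mul_mem
        (inv_mem (mem_KZ_of_level_eq_zero hϖ hlevel))
        (mem_KZ_of_level_eq_zero hϖ (Nat.le_zero.1 (hle.trans hlevel.le)))))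
    have hw0 : w = 0 := by
      refine Subtype.ext ((π.ρ.apply_bijective g).1 ?_)
      simpa [hb0] using hsum
    rw [hw0, map_zero]
    exact zero_mem _
  · have hw : (w : π.V) ∈ Iminus ϖ hϖ π σ := by
      obtain ⟨w', hw', e⟩ := neg_mem (hθ.fst_mem_map_Iminus hτ hg hb)
      rwa [← (π.ρ.apply_bijective g).1 (e.trans (eq_neg_of_add_eq_zero_left hsum).symm)]
    exact Submodule.mem_iSup_of_mem _ (Submodule.mem_iSup_of_mem (hg.level_mul_PiMat_lt hϖ hlevel)
      (hθ.mem_localGraph_mul_PiMat g hw))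

theorem exists_linearMap_apply_eq (hspan : orbitSpan π.ρ (τ.toSubmodule : Set π.V) = ⊤) :
    ∃ Θ : π.V →ₗ[k] X, ∀ g (w : τ.toSubmodule), Θ (π.ρ g w) = θ g w := by
  have hmem (g : GL (Fin 2) F) (w : τ.toSubmodule) :
      (π.ρ g w, θ g w) ∈ ⨆ g, localGraph θ g := Submodule.mem_iSup_of_mem g ⟨w, rfl⟩
  have hinj : Function.Injective (Prod.fst ∘ (⨆ g, localGraph θ g).subtype) := by
    have hdisj := disjoint_iSup_ker_of_level (f := LinearMap.fst k π.V X) (level := level ϖ)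
      fun x u hu b hb => hθ.mem_iSup_localGraph_level_lt hτ x hu hb
    exact LinearMap.injective_domRestrict_iff.2 hdisj
  have hsurj : Function.Surjective (Prod.fst ∘ (⨆ g, localGraph θ g).subtype) := by
    change Function.Surjective (LinearMap.fst k π.V X ∘ₗ (⨆ g, localGraph θ g).subtype)
    rw [← LinearMap.range_eq_top, eq_top_iff]
    refine (congrArg Subrepresentation.toSubmodule hspan).ge.trans (Submodule.span_le.2 ?_)
    rintro _ ⟨g, w, hw, rfl⟩
    exact ⟨⟨_, hmem g ⟨w, hw⟩⟩, rfl⟩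
  obtain ⟨Θ, hΘ⟩ := Submodule.exists_eq_graph ⟨hinj, hsurj⟩
  refine ⟨Θ, fun g w => ?_⟩
  have hgraph := hmem g w
  rw [hΘ] at hgraph
  exact ((LinearMap.mem_graph_iff Θ _).1 hgraph).symm

end IsLocallyCompatible

end LocalGraph

section FixedVectors

theorem charP_nsmul_eq_zero (p : ℕ) (k : Type*) {V : Type*} [Field k] [CharP k p] [AddCommGroup V]
    [Module k V] (v : V) : p • v = 0 := by
  rw [← Nat.cast_smul_eq_nsmul k, CharP.cast_eq_zero, zero_smul]

theorem finite_closure_of_charP (p : ℕ) [Fact p.Prime] (k : Type*) {V : Type*} [Field k] [CharP k p]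
    [AddCommGroup V] [Module k V] {s : Set V} (hs : s.Finite) :
    Finite (AddSubgroup.closure s) := by
  have := hs.to_subtype
  have hfg : AddGroup.FG (AddSubgroup.closure s) := AddGroup.closure_finite_fg s
  refine AddCommGroup.finite_of_fg_isAddTorsion _ fun x => ?_
  exact isOfFinAddOrder_iff_nsmul_eq_zero.2
    ⟨p, (Fact.out : p.Prime).pos, Subtype.ext (charP_nsmul_eq_zero p k (x : V))⟩

theorem prime_dvd_natCard_of_mem (p : ℕ) [Fact p.Prime] (k : Type*) {V : Type*} [Field k]
    [CharP k p] [AddCommGroup V] [Module k V] {A : AddSubgroup V} {v : V} (hv : v ∈ A)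
    (hv0 : v ≠ 0) : p ∣ Nat.card A := by
  have horder : addOrderOf (⟨v, hv⟩ : A) = p :=
    addOrderOf_eq_prime (Subtype.ext (charP_nsmul_eq_zero p k v))
      fun h => hv0 (congrArg Subtype.val h)
  exact horder.symm.dvd.trans (addOrderOf_dvd_natCard _)

variable {p : ℕ} [Fact p.Prime] {k H V : Type*} [Field k] [Group H] [AddCommGroup V] [Module k V]

theorem invariants_ne_bot_of_isPGroup [CharP k p] [Nontrivial V] [Finite H] (hH : IsPGroup p H)
    (ρ : Representation k H V) : ρ.invariants ≠ ⊥ := by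
  obtain ⟨v, hv⟩ := exists_ne (0 : V)
  let A : AddSubgroup V := AddSubgroup.closure (Set.range fun h => ρ h v)
  have hA (h : H) : A ≤ A.comap (ρ h).toAddMonoidHom := by
    refine (AddSubgroup.closure_le _).2 ?_
    rintro _ ⟨g, rfl⟩
    exact AddSubgroup.subset_closure ⟨h * g, by simp⟩
  have : Finite A := finite_closure_of_charP p k (Set.finite_range _)
  let _ : MulAction H A :=
    { smul h x := ⟨ρ h x, hA h x.2⟩
      one_smul x := Subtype.ext (by change ρ 1 (x : V) = x; simp)
      mul_smul g h x := Subtype.ext (by change ρ (g * h) (x : V) = ρ g (ρ h x); simp) }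
  have hvA : v ∈ A := AddSubgroup.subset_closure ⟨1, by simp⟩
  obtain ⟨w, hw, hw0⟩ := hH.exists_fixed_point_of_prime_dvd_card_of_fixed_point A
    (prime_dvd_natCard_of_mem p k hvA hv) (a := 0) fun h => Subtype.ext (map_zero (ρ h))
  refine (Submodule.ne_bot_iff _).2 ⟨w, fun h => congrArg Subtype.val (hw h), fun h => hw0 ?_⟩
  exact (Subtype.ext h).symm

theorem invariants_ne_bot_of_isPGroup_quotient [CharP k p] (ρ : Representation k H V)
    {N : Subgroup H} [N.Normal] [N.FiniteIndex] (hN : IsPGroup p (H ⧸ N))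
    (hinv : (res ρ N).invariants ≠ ⊥) : ρ.invariants ≠ ⊥ := by
  have : Nontrivial (Representation.invariants (MonoidHom.comp ρ N.subtype)) :=
    Submodule.nontrivial_iff_ne_bot.2 hinv
  obtain ⟨w, hw, hw0⟩ := Submodule.exists_mem_ne_zero_of_ne_bot
    (invariants_ne_bot_of_isPGroup hN (ρ.quotientToInvariants N))
  refine (Submodule.ne_bot_iff _).2 ⟨w, fun h => congrArg Subtype.val (hw h), fun h => hw0 ?_⟩
  exact Subtype.ext h

theorem finite_range_apply (ρ : Representation k H V) {N : Subgroup H} [N.FiniteIndex] {v : V}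
    (hv : v ∈ (res ρ N).invariants) : (Set.range fun h => ρ h v).Finite := by
  refine (Set.finite_range fun q : H ⧸ N => ρ q.out v).subset ?_
  rintro _ ⟨h, rfl⟩
  obtain ⟨n, hn⟩ := QuotientGroup.mk_out_eq_mul N h
  refine ⟨(h : H ⧸ N), ?_⟩
  simp only [hn, map_mul, Module.End.mul_apply]
  exact congrArg (ρ h) (hv n)

end FixedVectors

section Irreducible

variable {k H V : Type*} [Field k] [Group H] [AddCommGroup V] [Module k V]
  {ρ : Representation k H V}

/-- Subrepresentations of a subrepresentation `σ` are the subrepresentations contained in `σ`. -/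
def subrepresentationOrderIso (σ : Subrepresentation ρ) :
    Subrepresentation σ.toRepresentation ≃o Set.Iic σ where
  toFun T := ⟨⟨T.toSubmodule.map σ.toSubmodule.subtype, by
      rintro h _ ⟨x, hx, rfl⟩
      exact ⟨_, T.apply_mem_toSubmodule h hx, rfl⟩⟩, by
    rintro _ ⟨x, -, rfl⟩
    exact x.2⟩
  invFun S := ⟨S.1.toSubmodule.comap σ.toSubmodule.subtype, fun h _ hx =>
    S.1.apply_mem_toSubmodule h hx⟩
  left_inv T := Subrepresentation.toSubmodule_injective
    (Submodule.comap_map_eq_of_injective σ.toSubmodule.subtype_injective _)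
  right_inv S := Subtype.ext <| Subrepresentation.toSubmodule_injective <|
    (Submodule.map_comap_subtype _ _).trans (inf_eq_right.2 S.2)
  map_rel_iff' {T T'} :=
    Submodule.map_le_map_iff_of_injective σ.toSubmodule.subtype_injective
      T.toSubmodule T'.toSubmodule

theorem isIrreducible_iff_isAtom {σ : Subrepresentation ρ} :
    σ.toRepresentation.IsIrreducible ↔ IsAtom σ := by
  rw [← Set.isSimpleOrder_Iic_iff_isAtom]
  exact (subrepresentationOrderIso σ).isSimpleOrder_iff

theorem nontrivial_of_isIrreducible (ρ : Representation k H V) [ρ.IsIrreducible] :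
    Nontrivial V := by
  by_contra h
  rw [not_nontrivial_iff_subsingleton] at h
  exact bot_ne_top (α := Subrepresentation ρ)
    (Subrepresentation.toSubmodule_injective (Subsingleton.elim _ _))

theorem exists_isIrreducible_of_finite {τ : Subrepresentation ρ} [Module.Finite k τ.toSubmodule]
    {v : V} (hv : v ∈ τ) (hv0 : v ≠ 0) :
    ∃ σ : Subrepresentation ρ, σ.toRepresentation.IsIrreducible := by
  have : WellFoundedLT (Subrepresentation τ.toRepresentation) :=
    StrictMono.wellFoundedLT (f := Subrepresentation.toSubmodule) fun _ _ h => h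
  have : WellFoundedLT (Set.Iic τ) :=
    (subrepresentationOrderIso τ).symm.strictMono.wellFoundedLT
  have : IsAtomic (Set.Iic τ) := isAtomic_of_orderBot_wellFounded_lt this.wf
  obtain h | ⟨σ, hσ, -⟩ := eq_bot_or_exists_atom_le (⊤ : Set.Iic τ)
  · have hmem : v ∈ (⊥ : Subrepresentation ρ) := by
      rwa [show τ = ⊥ from congrArg Subtype.val h] at hv
    exact absurd ((Submodule.mem_bot k).1 hmem) hv0
  · exact ⟨σ, isIrreducible_iff_isAtom.2 hσ.of_isAtom_coe_Iic⟩

end Irreducible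

section CongruenceSubgroups

theorem mul_apply_mem_mul {ι R : Type*} [Fintype ι] [CommRing R] {I J : Ideal R}
    {A B : Matrix ι ι R} (hA : ∀ i j, A i j ∈ I) (hB : ∀ i j, B i j ∈ J) (i j : ι) :
    (A * B) i j ∈ I * J :=
  Ideal.sum_mem _ fun l _ => Ideal.mul_mem_mul (hA i l) (hB l j)

variable {ι R : Type*} [Fintype ι] [DecidableEq ι] [CommRing R]

/-- The principal congruence subgroup of `GLₙ(R)` of level `I`: the matrices congruent to `1`
modulo the ideal `I`. -/
def congruenceSubgroup (I : Ideal R) : Subgroup (GL ι R) :=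
  (GeneralLinearGroup.map (n := ι) (Ideal.Quotient.mk I)).ker

instance (I : Ideal R) : (congruenceSubgroup I : Subgroup (GL ι R)).Normal :=
  MonoidHom.normal_ker _

theorem mem_congruenceSubgroup_iff {I : Ideal R} {g : GL ι R} :
    g ∈ congruenceSubgroup I ↔ ∀ i j, (g.1 - 1) i j ∈ I := by
  rw [congruenceSubgroup, MonoidHom.mem_ker, GeneralLinearGroup.ext_iff]
  refine forall₂_congr fun i j => ?_
  rw [Matrix.sub_apply, ← Ideal.Quotient.eq, GeneralLinearGroup.map_apply, Units.val_one,
    Matrix.one_apply, Matrix.one_apply]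
  split_ifs <;> simp

theorem congruenceSubgroup_mono : Monotone (congruenceSubgroup (ι := ι) (R := R)) :=
  fun _ _ hIJ _ hg => mem_congruenceSubgroup_iff.2 fun i j =>
    hIJ (mem_congruenceSubgroup_iff.1 hg i j)

instance (I : Ideal R) [Finite (R ⧸ I)] :
    (congruenceSubgroup I : Subgroup (GL ι R)).FiniteIndex := by
  have : Finite (GL ι (R ⧸ I)) := Finite.of_injective (fun g => g.1) Units.val_injective
  exact Subgroup.finiteIndex_ker _

theorem pow_prime_mem_congruenceSubgroup {p : ℕ} (hp : p.Prime) {I J : Ideal R}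
    (hpI : (p : R) ∈ I) (hJI : J ≤ I) {g : GL ι R} (hg : g ∈ congruenceSubgroup J) :
    g ^ p ∈ congruenceSubgroup (I * J) := by
  let A : Matrix ι ι R := g.1 - 1
  have hA : ∀ i j, A i j ∈ J := mem_congruenceSubgroup_iff.1 hg
  obtain ⟨B, hB⟩ := (Commute.one_left A).exists_add_pow_prime_eq hp
  have hpow : (g ^ p).1 - 1 = A * (A * A ^ (p - 2)) + (p : R) • (A * B) := by
    have hg1 : g.1 = 1 + A := (add_sub_cancel 1 g.1).symm
    rw [Units.val_pow_eq_pow_val, hg1, hB, one_pow, mul_one, ← pow_succ', ← pow_succ', add_assoc,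
      add_sub_cancel_left, Nat.cast_smul_eq_nsmul, nsmul_eq_mul, mul_assoc]
    congr 2
    have := hp.two_le
    omega
  refine mem_congruenceSubgroup_iff.2 fun i j => ?_
  have hmul (C : Matrix ι ι R) (i j : ι) : (A * C) i j ∈ J := by
    simpa using mul_apply_mem_mul hA (J := ⊤) (fun _ _ => Submodule.mem_top) i j
  rw [hpow]
  exact add_mem (mul_apply_mem_mul (fun i j => hJI (hA i j)) (hmul _) i j)
    (Ideal.mul_mem_mul hpI (hmul B i j))

theorem pow_prime_pow_mem_congruenceSubgroup {p : ℕ} (hp : p.Prime) {I : Ideal R}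
    (hpI : (p : R) ∈ I) {g : GL ι R} (hg : g ∈ congruenceSubgroup I) (m : ℕ) :
    g ^ p ^ m ∈ congruenceSubgroup (I ^ (m + 1)) := by
  induction m with
  | zero => simpa using hg
  | succ m ih =>
    rw [pow_succ p, pow_mul, pow_succ' I]
    exact pow_prime_mem_congruenceSubgroup hp hpI (Ideal.pow_le_self m.succ_ne_zero) ih

theorem isPGroup_congruenceSubgroup_quotient {p : ℕ} (hp : p.Prime) {I : Ideal R}
    (hpI : (p : R) ∈ I) (n : ℕ) :
    IsPGroup p ((congruenceSubgroup I : Subgroup (GL ι R)) ⧸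
      (congruenceSubgroup (I ^ n)).subgroupOf (congruenceSubgroup I)) := by
  intro q
  obtain ⟨g, rfl⟩ := QuotientGroup.mk_surjective q
  refine ⟨n, (QuotientGroup.eq_one_iff (g ^ p ^ n)).2 ?_⟩
  exact congruenceSubgroup_mono (Ideal.pow_le_pow_right n.le_succ)
    (pow_prime_pow_mem_congruenceSubgroup hp hpI g.2 n)

theorem congruenceSubgroup_invariants_ne_bot {p : ℕ} [Fact p.Prime] {k V : Type*} [Field k]
    [CharP k p] [AddCommGroup V] [Module k V] {I : Ideal R} (hpI : (p : R) ∈ I) {n : ℕ}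
    [Finite (R ⧸ I ^ n)] (ρ : Representation k (GL ι R) V)
    (hinv : (res ρ (congruenceSubgroup (I ^ n))).invariants ≠ ⊥) :
    (res ρ (congruenceSubgroup I)).invariants ≠ ⊥ := by
  refine invariants_ne_bot_of_isPGroup_quotient _
    (isPGroup_congruenceSubgroup_quotient Fact.out hpI n) (ne_bot_of_le_ne_bot hinv ?_)
  exact fun v hv g => hv ⟨g, g.2⟩

end CongruenceSubgroups

section OpenSubgroups

variable {F : Type*} [Field F] [ValuativeRel F] [TopologicalSpace F] [IsNonarchimedeanLocalField F]

instance : Finite (𝒪[F] ⧸ 𝓂[F]) :=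
  inferInstanceAs (Finite 𝓀[F])

instance (n : ℕ) : Finite (𝒪[F] ⧸ 𝓂[F] ^ n) :=
  Ideal.finite_quotient_pow (IsNoetherian.noetherian _) n

theorem natCast_mem_maximalIdeal (p : ℕ) [CharP 𝓀[F] p] : (p : 𝒪[F]) ∈ 𝓂[F] := by
  rw [← IsLocalRing.residue_eq_zero_iff, map_natCast, CharP.cast_eq_zero]

theorem tendsto_zero_of_mem_maximalIdeal_pow {x : ℕ → 𝒪[F]} (hx : ∀ n, x n ∈ 𝓂[F] ^ n) :
    Filter.Tendsto (fun n => (x n : F)) Filter.atTop (nhds 0) := by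
  obtain ⟨ϖ, hϖ⟩ := IsDiscreteValuationRing.exists_irreducible 𝒪[F]
  rw [(IsValuativeTopology.hasBasis_nhds_zero' F).tendsto_right_iff]
  intro γ hγ
  obtain ⟨y, rfl⟩ := valuation_surjective γ
  obtain ⟨m, hm⟩ := exists_valuation_eq_zpow hϖ (x := y) (by simpa using hγ)
  filter_upwards [Filter.eventually_ge_atTop (m.toNat + 1)] with n hn
  have hxn := hx n
  rw [hϖ.maximalIdeal_eq, Ideal.span_singleton_pow, Ideal.mem_span_singleton] at hxn
  obtain ⟨c, hc⟩ := hxn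
  calc valuation F (x n : F) = valuation F (ϖ : F) ^ n * valuation F (c : F) := by
        rw [hc, ← map_pow, ← map_mul]; rfl
    _ ≤ valuation F (ϖ : F) ^ n := mul_le_of_le_one_right' c.2
    _ < valuation F y := by
        rw [hm, ← zpow_natCast, zpow_lt_zpow_iff_right_of_lt_one₀
          (Valuation.integer.v_irreducible_pos hϖ) (Valuation.integer.v_irreducible_lt_one hϖ)]
        omega

theorem tendsto_map_one_of_mem_congruenceSubgroup {ι : Type*} [Fintype ι] [DecidableEq ι]
    {g : ℕ → GL ι 𝒪[F]} (hg : ∀ n, g n ∈ congruenceSubgroup (𝓂[F] ^ n)) :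
    Filter.Tendsto (fun n => GeneralLinearGroup.map (algebraMap 𝒪[F] F) (g n)) Filter.atTop
      (nhds 1) := by
  have hcoe (x : 𝒪[F]) : algebraMap 𝒪[F] F x = x := rfl
  have hval (h : ℕ → GL ι 𝒪[F]) (hh : ∀ n, h n ∈ congruenceSubgroup (𝓂[F] ^ n)) :
      Filter.Tendsto (fun n => (GeneralLinearGroup.map (algebraMap 𝒪[F] F) (h n)).1) Filter.atTop
        (nhds 1) := by
    refine tendsto_pi_nhds.2 fun i => tendsto_pi_nhds.2 fun j => ?_
    rw [← tendsto_sub_nhds_zero_iff]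
    convert tendsto_zero_of_mem_maximalIdeal_pow
      fun n => mem_congruenceSubgroup_iff.1 (hh n) i j using 2 with n
    rw [Matrix.sub_apply, Matrix.one_apply, Matrix.one_apply]
    split_ifs <;> simp [hcoe]
  rw [Units.isEmbedding_embedProduct.tendsto_nhds_iff]
  refine (hval g hg).prodMk_nhds ((MulOpposite.continuous_op.tendsto _).comp ?_)
  simpa only [map_inv, inv_one] using! hval (fun n => (g n)⁻¹) fun n => inv_mem (hg n)

end OpenSubgroups

section CongruenceInvariants

variable {F : Type*} [Field F] [ValuativeRel F]
  {k V : Type*} [Field k] [AddCommGroup V] [Module k V]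

/-- The embedding of `GL₂(𝒪)` into `KZ`. -/
noncomputable def integralHom (F : Type*) [Field F] [ValuativeRel F] : GL (Fin 2) 𝒪[F] →* KZ F :=
  (GeneralLinearGroup.map (algebraMap 𝒪[F] F)).codRestrict (KZ F)
    fun g => Subgroup.mem_sup_left ⟨g, rfl⟩

theorem exists_integralHom_mul_eq (h : KZ F) :
    ∃ (a : GL (Fin 2) 𝒪[F]) (z : KZ F),
      (z : GL (Fin 2) F) ∈ Subgroup.center (GL (Fin 2) F) ∧ integralHom F a * z = h := by
  obtain ⟨_, ⟨a, rfl⟩, z, hz, e⟩ := Subgroup.mem_sup_of_normal_right.1 h.2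
  exact ⟨a, ⟨z, Subgroup.mem_sup_right hz⟩, hz, Subtype.ext e⟩

theorem exists_integralHom_congr_mul_comm {I : Ideal 𝒪[F]} {g : GL (Fin 2) 𝒪[F]}
    (hg : g ∈ congruenceSubgroup I) (h : KZ F) :
    ∃ g' ∈ congruenceSubgroup I, integralHom F g * h = h * integralHom F g' := by
  obtain ⟨a, z, hz, rfl⟩ := exists_integralHom_mul_eq h
  refine ⟨a⁻¹ * g * a, by
    simpa using (inferInstance : (congruenceSubgroup I).Normal).conj_mem g hg a⁻¹, ?_⟩
  have hcomm (x : KZ F) : z * x = x * z := Subtype.ext (Subgroup.mem_center_iff.1 hz x).symm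
  rw [mul_assoc _ z, hcomm, map_mul, map_mul, map_inv]
  group

/-- The vectors of a representation of `KZ` fixed by the first congruence subgroup of `GL₂(𝒪)`. -/
noncomputable def congruenceInvariants (τ : Representation k (KZ F) V) : Subrepresentation τ where
  toSubmodule :=
    (res (τ.comp (integralHom F)) (congruenceSubgroup (IsLocalRing.maximalIdeal 𝒪[F]))).invariants
  apply_mem_toSubmodule h v hv := by
    rintro ⟨g, hg⟩
    obtain ⟨g', hg', e⟩ := exists_integralHom_congr_mul_comm hg h
    change τ (integralHom F g) (τ h v) = τ h v
    rw [← Module.End.mul_apply, ← map_mul, e, map_mul, Module.End.mul_apply]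
    exact congrArg (τ h) (hv ⟨g', hg'⟩)

variable [TopologicalSpace F] [IsNonarchimedeanLocalField F]

theorem exists_congruenceSubgroup_le {U : Subgroup (KZ F)} (hU : IsOpen (U : Set (KZ F))) :
    ∃ n, congruenceSubgroup (𝓂[F] ^ n) ≤ U.comap (integralHom F) := by
  by_contra! h
  choose g hg hgU using fun n => SetLike.not_le_iff_exists.1 (h n)
  have hlim : Filter.Tendsto (fun n => integralHom F (g n)) Filter.atTop (nhds 1) :=
    tendsto_subtype_rng.2 (tendsto_map_one_of_mem_congruenceSubgroup hg)
  obtain ⟨n, hn⟩ := (hlim.eventually (hU.mem_nhds (one_mem U))).exists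
  exact hgU n hn

theorem exists_mem_invariants_congruenceSubgroup {τ : Representation k (KZ F) V} (hτ : IsSmooth τ)
    (v : V) :
    ∃ n, v ∈ (res (τ.comp (integralHom F)) (congruenceSubgroup (𝓂[F] ^ n))).invariants := by
  obtain ⟨U, hU, hv⟩ := hτ v
  obtain ⟨n, hn⟩ := exists_congruenceSubgroup_le hU
  exact ⟨n, fun g => hv _ (hn g.2)⟩

theorem congruenceInvariants_ne_bot {p : ℕ} [Fact p.Prime] [CharP 𝓀[F] p] [CharP k p]
    [Nontrivial V] {τ : Representation k (KZ F) V} (hτ : IsSmooth τ) :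
    congruenceInvariants τ ≠ ⊥ := by
  obtain ⟨v, hv⟩ := exists_ne (0 : V)
  obtain ⟨n, hn⟩ := exists_mem_invariants_congruenceSubgroup hτ v
  intro h
  exact congruenceSubgroup_invariants_ne_bot (natCast_mem_maximalIdeal p)
    (τ.comp (integralHom F)) ((Submodule.ne_bot_iff _).2 ⟨v, hn, hv⟩)
    (congrArg Subrepresentation.toSubmodule h)

theorem congruenceInvariants_eq_top {p : ℕ} [Fact p.Prime] [CharP 𝓀[F] p] [CharP k p]
    {τ : Representation k (KZ F) V} [τ.IsIrreducible] (hτ : IsSmooth τ) :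
    congruenceInvariants τ = ⊤ :=
  have := nontrivial_of_isIrreducible τ
  (eq_bot_or_eq_top _).resolve_left (congruenceInvariants_ne_bot (p := p) hτ)

theorem finite_orbitSpan_singleton {ρ : Representation k (GL (Fin 2) F) V} (hρ : IsSmooth ρ)
    (hcent : HasCentralCharacter ρ) (v : V) :
    Module.Finite k (orbitSpan (res ρ (KZ F)) {v}).toSubmodule := by
  obtain ⟨χ, hχ⟩ := hcent
  obtain ⟨n, hn⟩ := exists_mem_invariants_congruenceSubgroup (hρ.res (KZ F)) v
  have := Module.Finite.span_of_finite k (finite_range_apply _ hn)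
  refine Submodule.finiteDimensional_of_le
    (S₂ := Submodule.span k (Set.range fun a => res ρ (KZ F) (integralHom F a) v))
    (Submodule.span_le.2 ?_)
  rintro _ ⟨h, w, hw, rfl⟩
  obtain ⟨a, z, hz, rfl⟩ := exists_integralHom_mul_eq h
  have hzv : res ρ (KZ F) z v = (χ ⟨z, hz⟩ : k) • v := hχ ⟨z, hz⟩ v
  rw [Set.mem_singleton_iff.1 hw, map_mul, Module.End.mul_apply, hzv, map_smul]
  exact Submodule.smul_mem _ _ (Submodule.subset_span ⟨a, rfl⟩)

theorem exists_isIrreducible_res_KZ [Nontrivial V] {ρ : Representation k (GL (Fin 2) F) V}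
    (hρ : IsSmooth ρ) (hcent : HasCentralCharacter ρ) :
    ∃ σ : Subrepresentation (res ρ (KZ F)), σ.toRepresentation.IsIrreducible := by
  obtain ⟨v, hv⟩ := exists_ne (0 : V)
  have := finite_orbitSpan_singleton hρ hcent v
  exact exists_isIrreducible_of_finite (mem_orbitSpan _ (Set.mem_singleton v)) hv

end CongruenceInvariants

section Mirabolic

variable {F : Type*} [Field F] [ValuativeRel F] {ϖ : 𝒪[F]}

/-- The group of the matrices `(ϖⁿ t; 0 1)` with `n : ℤ` and `t : F`. -/
noncomputable def mirabolic (hϖ : Irreducible ϖ) : Subgroup (GL (Fin 2) F) where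
  carrier := {g | (∃ n : ℤ, g.1 0 0 = (ϖ : F) ^ n) ∧ g.1 1 0 = 0 ∧ g.1 1 1 = 1}
  one_mem' := ⟨⟨0, by simp⟩, by simp⟩
  mul_mem' := by
    rintro g h ⟨⟨m, hm⟩, hg0, hg1⟩ ⟨⟨n, hn⟩, hh0, hh1⟩
    have hϖ0 : (ϖ : F) ≠ 0 := by simpa using hϖ.ne_zero
    exact ⟨⟨m + n, by simp [Matrix.mul_apply, hm, hn, hh0, zpow_add₀ hϖ0]⟩,
      by simp [Matrix.mul_apply, hg0, hh0], by simp [Matrix.mul_apply, hg0, hg1, hh1]⟩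
  inv_mem' := by
    rintro g ⟨⟨n, hn⟩, h0, h1⟩
    have hϖ0 : (ϖ : F) ≠ 0 := by simpa using hϖ.ne_zero
    have hdet : g.1.det = (ϖ : F) ^ n := by rw [Matrix.det_fin_two, h0, h1, hn]; ring
    have hinv : (g⁻¹).1 = ((ϖ : F) ^ n)⁻¹ • !![1, -g.1 0 1; 0, (ϖ : F) ^ n] := by
      rw [GeneralLinearGroup.coe_inv, Matrix.inv_def, hdet, Ring.inverse_eq_inv',
        Matrix.adjugate_fin_two, h0, h1, hn, neg_zero]
    refine ⟨⟨-n, ?_⟩, ?_, ?_⟩ <;> simp [hinv, zpow_ne_zero n hϖ0]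

theorem exists_mul_mem_mirabolic [TopologicalSpace F] [IsNonarchimedeanLocalField F]
    (hϖ : Irreducible ϖ) (g : GL (Fin 2) F) : ∃ h ∈ KZ F, g * h ∈ mirabolic hϖ := by
  obtain ⟨h, hh, h0, h1⟩ := exists_mem_KZ_mul_apply_eq g 1
  have hne : (g * h).1 0 0 ≠ 0 := fun h00 =>
    GeneralLinearGroup.det_ne_zero (g * h) (by rw [Matrix.det_fin_two, h0, h00]; ring)
  obtain ⟨n, hn⟩ := exists_valuation_eq_zpow hϖ hne
  set u := (ϖ : F) ^ n / (g * h).1 0 0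
  have hunit : valuation F u = 1 := by
    rw [map_div₀, hn, map_zpow₀,
      div_self (zpow_ne_zero n (Valuation.integer.v_irreducible_pos hϖ).ne')]
  obtain ⟨c, hc, e⟩ := exists_mem_maxCompact_coe_eq (A := !![u, 0; 0, 1])
    (by simp [Fin.forall_fin_two, hunit]) (by simp [hunit])
  have hmul (i : Fin 2) :
      (g * (h * c)).1 i 0 = (g * h).1 i 0 * u ∧ (g * (h * c)).1 i 1 = (g * h).1 i 1 := by
    rw [← mul_assoc, GeneralLinearGroup.coe_mul, e]
    simp [Matrix.mul_apply]
  refine ⟨h * c, mul_mem hh (Subgroup.mem_sup_left hc), ⟨n, ?_⟩, ?_, ?_⟩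
  · rw [(hmul 0).1, mul_div_cancel₀ _ hne]
  · rw [(hmul 1).1, h0, zero_mul]
  · rw [(hmul 1).2, h1]

theorem exists_integralHom_upperRightHom_eq {hϖ : Irreducible ϖ} {g : KZ F}
    (hg : (g : GL (Fin 2) F) ∈ mirabolic hϖ) :
    ∃ t : 𝒪[F], integralHom F (GeneralLinearGroup.upperRightHom t) = g := by
  obtain ⟨⟨n, hn⟩, h0, h1⟩ := hg
  have hdet : valuation F (g.1.1 0 0) = entryNorm (valuation F) g.1.1 ^ 2 := by
    rw [← mem_KZ_iff.1 g.2, Matrix.det_fin_two, h0, h1, mul_one, mul_zero, sub_zero]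
  have hone : 1 ≤ entryNorm (valuation F) g.1.1 := by
    simpa [h1] using le_entryNorm (valuation F) g.1.1 1 1
  have hnorm : entryNorm (valuation F) g.1.1 = 1 := by
    refine (le_antisymm ?_ hone)
    have hle := le_entryNorm (valuation F) g.1.1 0 0
    rw [hdet, sq] at hle
    exact (mul_le_iff_le_one_right (entryNorm_pos _)).1 hle
  have hn0 : n = 0 := by
    rw [hnorm, hn, one_pow, map_zpow₀] at hdet
    exact (zpow_eq_one_iff_right₀ (Valuation.integer.v_irreducible_pos hϖ).le
      (Valuation.integer.v_irreducible_lt_one hϖ).ne).1 hdet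
  let t : 𝒪[F] := ⟨g.1.1 0 1, (le_entryNorm (valuation F) g.1.1 0 1).trans hnorm.le⟩
  refine ⟨t, Subtype.ext (GeneralLinearGroup.ext fun i j => ?_)⟩
  change (((GeneralLinearGroup.upperRightHom t).1 i j : 𝒪[F]) : F) = g.1.1 i j
  fin_cases i <;> fin_cases j <;> simp [GeneralLinearGroup.upperRightHom, t, hn, h0, h1, hn0]

end Mirabolic

section Functionals

theorem exists_forall_mul_eq_comp {k G W X : Type*} [Field k] [Group G] [AddCommGroup W]
    [Module k W] [AddCommGroup X] [Module k X] {B H : Subgroup G}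
    (hBH : ∀ g, ∃ h ∈ H, g * h ∈ B) (τ : Representation k H W) {ψ : W →ₗ[k] X}
    (hψ : ∀ h : H, (h : G) ∈ B → ψ ∘ₗ τ h = ψ) :
    ∃ θ : G → W →ₗ[k] X, θ 1 = ψ ∧ (∀ g (h : H), θ (g * h) = θ g ∘ₗ τ h) ∧
      ∀ b ∈ B, ∀ g, θ (b * g) = θ g := by
  choose c hcH hcB using hBH
  let θ (g : G) : W →ₗ[k] X := ψ ∘ₗ τ ⟨c g, hcH g⟩⁻¹
  have hθ (g : G) (h : H) (hgh : g * h ∈ B) : θ g = ψ ∘ₗ τ h⁻¹ := by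
    have hmem : (c g)⁻¹ * h ∈ B := by
      simpa [mul_assoc] using mul_mem (inv_mem (hcB g)) hgh
    rw [← hψ (⟨c g, hcH g⟩⁻¹ * h) hmem, LinearMap.comp_assoc, ← Module.End.mul_eq_comp, ← map_mul,
      mul_inv_cancel_right]
  refine ⟨θ, ?_, fun g h => ?_, fun b hb g => ?_⟩
  · rw [hθ 1 1 (by simp), inv_one, map_one, Module.End.one_eq_id, LinearMap.comp_id]
  · rw [hθ (g * h) (h⁻¹ * ⟨c g, hcH g⟩) (by simpa [mul_assoc] using hcB g), _root_.mul_inv_rev,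
      inv_inv, map_mul, Module.End.mul_eq_comp, ← LinearMap.comp_assoc]
  · exact hθ (b * g) ⟨c g, hcH g⟩ (by simpa [mul_assoc] using mul_mem hb (hcB g))

theorem eq_zero_of_forall_apply_eq_zero {k G V : Type*} [Field k] [Group G] [AddCommGroup V]
    [Module k V] {ρ : Representation k G V} [ρ.IsIrreducible] {ψ : Module.Dual k V} (hψ : ψ ≠ 0)
    {x : V} (hx : ∀ g, ψ (ρ g x) = 0) : x = 0 := by
  by_contra hx0
  refine hψ (linearMap_ext_of_orbitSpan_eq_top
    (orbitSpan_eq_top (ρ := ρ) (Set.mem_singleton x) hx0) fun g v hv => ?_)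
  rw [Set.mem_singleton_iff.1 hv, hx, LinearMap.zero_apply]

variable {F : Type*} [Field F] [ValuativeRel F] [TopologicalSpace F] [IsNonarchimedeanLocalField F]
  {k V : Type*} [Field k] [AddCommGroup V] [Module k V]

theorem isPGroup_comap_upperRightHom (p : ℕ) [CharP 𝓀[F] p] :
    IsPGroup p (Multiplicative 𝒪[F] ⧸ (congruenceSubgroup 𝓂[F]).comap
      (GeneralLinearGroup.upperRightHom (R := 𝒪[F])).toMonoidHom) := by
  rintro ⟨t⟩
  refine ⟨1, (QuotientGroup.eq_one_iff _).2 ?_⟩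
  change GeneralLinearGroup.upperRightHom (R := 𝒪[F]) (p ^ 1 • t.toAdd) ∈ congruenceSubgroup 𝓂[F]
  have hpt : (p : 𝒪[F]) * t.toAdd ∈ 𝓂[F] := Ideal.mul_mem_right _ _ (natCast_mem_maximalIdeal p)
  rw [mem_congruenceSubgroup_iff]
  intro i j
  fin_cases i <;> fin_cases j <;> simp_all [GeneralLinearGroup.upperRightHom]

theorem exists_dual_upperRightHom_invariant {p : ℕ} [Fact p.Prime] [CharP 𝓀[F] p] [CharP k p]
    [Nontrivial V] {τ : Representation k (KZ F) V} (hτ : congruenceInvariants τ = ⊤) :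
    ∃ ψ : Module.Dual k V, ψ ≠ 0 ∧
      ∀ t v, ψ (τ (integralHom F (GeneralLinearGroup.upperRightHom t)) v) = ψ v := by
  have : ((congruenceSubgroup 𝓂[F]).comap
      (GeneralLinearGroup.upperRightHom (R := 𝒪[F])).toMonoidHom).FiniteIndex :=
    ⟨by rw [Subgroup.index_comap]; exact Subgroup.FiniteIndex.index_ne_zero⟩
  let μ : Representation k (Multiplicative 𝒪[F]) (Module.Dual k V) :=
    τ.dual.comp ((integralHom F).comp GeneralLinearGroup.upperRightHom.toMonoidHom)
  obtain ⟨ψ₀, hψ₀⟩ := exists_ne (0 : Module.Dual k V)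
  have hinv : ψ₀ ∈ (res μ ((congruenceSubgroup 𝓂[F]).comap
      GeneralLinearGroup.upperRightHom.toMonoidHom)).invariants := by
    rintro ⟨t, ht⟩
    refine LinearMap.ext fun v => congrArg ψ₀ ?_
    have hv : v ∈ congruenceInvariants τ := hτ ▸ Submodule.mem_top
    exact (congrArg _ (hv ⟨_, ht⟩).symm).trans (τ.inv_self_apply _ v)
  obtain ⟨ψ, hψ, hψ0⟩ := Submodule.exists_mem_ne_zero_of_ne_bot
    (invariants_ne_bot_of_isPGroup_quotient μ (isPGroup_comap_upperRightHom p)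
      ((Submodule.ne_bot_iff _).2 ⟨ψ₀, hinv, hψ₀⟩))
  refine ⟨ψ, hψ0, fun t v => ?_⟩
  rw [← LinearMap.congr_fun (hψ (.ofAdd t))]
  exact congrArg ψ (τ.inv_self_apply _ v)

theorem finite_congruenceInvariants {ϖ : 𝒪[F]} (hϖ : Irreducible ϖ)
    {ρ : Representation k (GL (Fin 2) F) V} [ρ.IsIrreducible] (hcent : HasCentralCharacter ρ)
    {ψ : Module.Dual k V} (hψ : ψ ≠ 0) (hinv : ∀ b ∈ mirabolic hϖ, ∀ v, ψ (ρ b v) = ψ v) :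
    Module.Finite k (congruenceInvariants (res ρ (KZ F))).toSubmodule := by
  obtain ⟨χ, hχ⟩ := hcent
  let evalOut : (congruenceInvariants (res ρ (KZ F))).toSubmodule →ₗ[k]
      GL (Fin 2) 𝒪[F] ⧸ congruenceSubgroup 𝓂[F] → k :=
    LinearMap.pi fun q => ψ ∘ₗ ρ (integralHom F q.out) ∘ₗ Submodule.subtype _
  refine Module.Finite.of_injective evalOut ((injective_iff_map_eq_zero evalOut).2 fun x hx => ?_)
  have integral (a : GL (Fin 2) 𝒪[F]) : ψ (ρ (integralHom F a) x) = 0 := by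
    obtain ⟨γ, hγ⟩ := QuotientGroup.mk_out_eq_mul (congruenceSubgroup 𝓂[F]) a
    have hq : ψ (ρ (integralHom F (a * γ)) x) = 0 := by
      rw [← hγ]
      exact congrFun hx _
    have hfix : ρ (integralHom F γ) x = x := x.2 γ
    rwa [map_mul, Subgroup.coe_mul, map_mul, Module.End.mul_apply, hfix] at hq
  have onKZ (h : KZ F) : ψ (ρ h x) = 0 := by
    obtain ⟨a, z, hz, rfl⟩ := exists_integralHom_mul_eq h
    have hzx : ρ z x = (χ ⟨z, hz⟩ : k) • (x : V) := hχ ⟨z, hz⟩ x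
    rw [Subgroup.coe_mul, map_mul, Module.End.mul_apply, hzx, map_smul, map_smul, integral,
      smul_zero]
  refine Subtype.ext (eq_zero_of_forall_apply_eq_zero (ρ := ρ) hψ fun g => ?_)
  obtain ⟨h, hh, hb⟩ := exists_mul_mem_mirabolic hϖ g
  rw [← hinv _ (inv_mem hb), ← Module.End.mul_apply, ← map_mul]
  simpa using onKZ ⟨h⁻¹, inv_mem hh⟩

end Functionals

section Nondegenerate

universe u v w w'

variable {F : Type u} [Field F] [ValuativeRel F] [TopologicalSpace F]
  {k : Type v} [Field k] {π : SmoothRep.{u, v, w} F k}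
  {ϖ : 𝒪[F]} {hϖ : Irreducible ϖ} {σ : Subrepresentation (res π.ρ (KZ F))}

/-- The `KZ`-subrepresentation spanned by the translates of `σ` at the vertices of the tree at
distance `n` from `KZ`. -/
noncomputable def sphere (ϖ : 𝒪[F]) (σ : Subrepresentation (res π.ρ (KZ F))) (n : ℕ) :
    Subrepresentation (res π.ρ (KZ F)) :=
  orbitSpan (res π.ρ (KZ F)) {y | ∃ g, level ϖ g = n ∧ ∃ x ∈ σ, π.ρ g x = y}

theorem nontrivial_sphere (hϖ : Irreducible ϖ) (hσ : σ ≠ ⊥) (n : ℕ) :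
    Nontrivial (sphere ϖ σ n).toSubmodule := by
  obtain ⟨g, hg⟩ := exists_level_eq hϖ n
  obtain ⟨x, hx, hx0⟩ := Submodule.exists_mem_ne_zero_of_ne_bot
    (Subrepresentation.toSubmodule_injective.ne hσ)
  refine ⟨⟨π.ρ g x, mem_orbitSpan _ ⟨g, hg, x, hx, rfl⟩⟩, 0, fun h => hx0 ?_⟩
  exact (map_eq_zero_iff _ (π.ρ.apply_bijective g).1).1 (congrArg Subtype.val h)

variable [IsNonarchimedeanLocalField F]

-- With `D₁(π) = 0` the edge condition is void, so `π` is compactly induced from `σ`.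
theorem exists_linearMap_apply_eq_of_D₁_eq_bot (hD₁ : D₁ ϖ hϖ π σ = ⊥)
    (hspan : orbitSpan π.ρ (σ.toSubmodule : Set π.V) = ⊤) {X : Type w'} [AddCommGroup X]
    [Module k X] {θ : GL (Fin 2) F → σ.toSubmodule →ₗ[k] X}
    (hθ : ∀ g (h : KZ F), θ (g * h) = θ g ∘ₗ σ.toRepresentation h) :
    ∃ Θ : π.V →ₗ[k] X, ∀ g (w : σ.toSubmodule), Θ (π.ρ g w) = θ g w := by
  have hcompat : IsLocallyCompatible ϖ hϖ σ θ := by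
    refine ⟨fun g h w => LinearMap.congr_fun (hθ g h) w, fun g w hw => ?_⟩
    have hw0 : (w : π.V) = 0 := by
      have hmem : (w : π.V) ∈ D₁ ϖ hϖ π σ := ⟨le_Iplus π σ w.2, hw⟩
      rw [hD₁] at hmem
      exact (Submodule.mem_bot k).1 hmem
    obtain rfl : w = 0 := Subtype.ext hw0
    exact ⟨0, by simp⟩
  exact hcompat.exists_linearMap_apply_eq (le_Iplus π σ) hspan

theorem exists_linearMap_sphere_eq_ite (hD₁ : D₁ ϖ hϖ π σ = ⊥)
    (hspan : orbitSpan π.ρ (σ.toSubmodule : Set π.V) = ⊤) (n : ℕ) :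
    ∃ Θ : π.V →ₗ[k] π.V, ∀ m, ∀ x ∈ sphere ϖ σ m, Θ x = if m = n then x else 0 := by
  let θ (g : GL (Fin 2) F) : σ.toSubmodule →ₗ[k] π.V :=
    if level ϖ g = n then π.ρ g ∘ₗ σ.toSubmodule.subtype else 0
  obtain ⟨Θ, hΘ⟩ := exists_linearMap_apply_eq_of_D₁_eq_bot hD₁ hspan (θ := θ) fun g h => by
    simp only [θ, level_mul_right hϖ g h.2, map_mul]
    split_ifs <;> rfl
  refine ⟨Θ, fun m x hx => ?_⟩
  suffices Set.EqOn Θ (if m = n then LinearMap.id else 0 : π.V →ₗ[k] π.V) (sphere ϖ σ m) by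
    rw [this hx]
    split_ifs <;> rfl
  refine LinearMap.eqOn_span' ?_
  rintro _ ⟨h, _, ⟨g, rfl, x, hx, rfl⟩, rfl⟩
  have e : res π.ρ (KZ F) h (π.ρ g x) = π.ρ (h * g) x := by rw [map_mul]; rfl
  rw [e, hΘ (h * g) ⟨x, hx⟩]
  simp only [θ, level_mul_left hϖ g h.2]
  split_ifs <;> rfl

theorem exists_dual_mirabolic_invariant {p : ℕ} [Fact p.Prime] [CharP 𝓀[F] p] [CharP k p]
    [π.ρ.IsIrreducible] (hσ : σ.toRepresentation.IsIrreducible) (hD₁ : D₁ ϖ hϖ π σ = ⊥) :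
    ∃ ψ : Module.Dual k π.V, ψ ≠ 0 ∧ ∀ b ∈ mirabolic hϖ, ∀ v, ψ (π.ρ b v) = ψ v := by
  have := nontrivial_of_isIrreducible σ.toRepresentation
  have hspan := orbitSpan_toSubmodule_eq_top (isIrreducible_iff_isAtom.1 hσ).1
  obtain ⟨ψ₀, hψ₀, hinv⟩ := exists_dual_upperRightHom_invariant (p := p)
    (congruenceInvariants_eq_top (p := p) ((π.smooth.res (KZ F)).toRepresentation σ))
  obtain ⟨θ, hθ1, hθKZ, hθB⟩ := exists_forall_mul_eq_comp (exists_mul_mem_mirabolic hϖ)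
    σ.toRepresentation (ψ := ψ₀) fun h hh => by
      obtain ⟨t, rfl⟩ := exists_integralHom_upperRightHom_eq hh
      exact LinearMap.ext (hinv t)
  obtain ⟨ψ, hψ⟩ := exists_linearMap_apply_eq_of_D₁_eq_bot hD₁ hspan hθKZ
  refine ⟨ψ, fun h0 => hψ₀ (LinearMap.ext fun w => ?_), fun b hb => LinearMap.congr_fun
    (f := ψ ∘ₗ π.ρ b) (linearMap_ext_of_orbitSpan_eq_top hspan fun g w hw => ?_)⟩
  · rw [← hθ1, ← hψ, h0, LinearMap.zero_apply, LinearMap.zero_apply]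
  · rw [LinearMap.comp_apply, ← Module.End.mul_apply, ← map_mul, hψ (b * g) ⟨w, hw⟩,
      hψ g ⟨w, hw⟩, hθB b hb]

theorem exists_mem_sphere_mem_congruenceInvariants {p : ℕ} [Fact p.Prime] [CharP 𝓀[F] p]
    [CharP k p] (hϖ : Irreducible ϖ) (hσ : σ ≠ ⊥) (n : ℕ) :
    ∃ x ∈ sphere ϖ σ n, x ∈ congruenceInvariants (res π.ρ (KZ F)) ∧ x ≠ 0 := by
  have := nontrivial_sphere hϖ hσ n
  have hne := congruenceInvariants_ne_bot (p := p)
    ((π.smooth.res (KZ F)).toRepresentation (sphere ϖ σ n))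
  obtain ⟨x, hx, hx0⟩ := Submodule.exists_mem_ne_zero_of_ne_bot
    (Subrepresentation.toSubmodule_injective.ne hne)
  exact ⟨x, x.2, fun g => congrArg Subtype.val (hx g), fun h => hx0 (Subtype.ext h)⟩

-- If `D₁(π) = 0`, the spheres contribute independent vectors to a space which the orbits of a
-- mirabolic invariant functional show to be finite dimensional.
theorem D₁_ne_bot {p : ℕ} [Fact p.Prime] [CharP 𝓀[F] p] [CharP k p] [π.ρ.IsIrreducible]
    (hcent : HasCentralCharacter π.ρ) (hσ : σ.toRepresentation.IsIrreducible) :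
    D₁ ϖ hϖ π σ ≠ ⊥ := by
  intro hD₁
  have hσ0 : σ ≠ ⊥ := (isIrreducible_iff_isAtom.1 hσ).1
  obtain ⟨ψ, hψ, hinv⟩ := exists_dual_mirabolic_invariant (p := p) hσ hD₁
  have := finite_congruenceInvariants hϖ hcent hψ hinv
  choose x hx hxinv hx0 using exists_mem_sphere_mem_congruenceInvariants (p := p) hϖ hσ0
  choose Θ hΘ using exists_linearMap_sphere_eq_ite hD₁ (orbitSpan_toSubmodule_eq_top hσ0)
  have hindep : LinearIndependent k fun n =>
      (⟨x n, hxinv n⟩ : (congruenceInvariants (res π.ρ (KZ F))).toSubmodule) := by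
    refine .of_comp (Submodule.subtype _) (linearIndependent_iff'.2 fun s c hc n hn => ?_)
    have hsum := congrArg (Θ n) hc
    simpa [hΘ _ _ _ (hx _), hn, hx0] using hsum
  exact not_finite_iff_infinite.2 inferInstance hindep.finite_of_isNoetherian

end Nondegenerate

section Extension

universe u v w w'

variable {F : Type u} [Field F] [ValuativeRel F] [TopologicalSpace F]
  {k : Type v} [Field k] {π : SmoothRep.{u, v, w} F k} {π' : SmoothRep.{u, v, w'} F k}
  {ϖ : 𝒪[F]} {hϖ : Irreducible ϖ} {σ : Subrepresentation (res π.ρ (KZ F))}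

theorem exists_intertwiningMap_apply_eq {τ : Subrepresentation (res π.ρ (KZ F))}
    (hspan : orbitSpan π.ρ (τ.toSubmodule : Set π.V) = ⊤) {φ : τ.toSubmodule →ₗ[k] π'.V}
    {Θ : π.V →ₗ[k] π'.V} (hΘ : ∀ g (w : τ.toSubmodule), Θ (π.ρ g w) = π'.ρ g (φ w)) :
    ∃ Φ : π.ρ.IntertwiningMap π'.ρ, ∀ w : τ.toSubmodule, Φ w = φ w := by
  refine ⟨⟨Θ, fun h => linearMap_ext_of_orbitSpan_eq_top hspan fun g w hw => ?_⟩, fun w => ?_⟩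
  · change Θ (π.ρ h (π.ρ g w)) = π'.ρ h (Θ (π.ρ g w))
    rw [← Module.End.mul_apply, ← map_mul, hΘ (h * g) ⟨w, hw⟩, hΘ g ⟨w, hw⟩, map_mul,
      Module.End.mul_apply]
  · change Θ w = φ w
    simpa using hΘ 1 w

variable [IsNonarchimedeanLocalField F]

/-- The restriction to the canonical diagram of `𝒦(φ)`. -/
noncomputable def restrictHom (ϖ : 𝒪[F]) (hϖ : Irreducible ϖ) (π : SmoothRep.{u, v, w} F k)
    (σ : Subrepresentation (res π.ρ (KZ F))) (π' : SmoothRep.{u, v, w'} F k) :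
    π.ρ.IntertwiningMap π'.ρ →ₗ[k]
      Diagram.Hom (canonicalDiagram ϖ hϖ π σ) (Diagram.calK π') where
  toFun φ := Diagram.comp (Diagram.calK.map φ) (canonicalDiagram.incl ϖ hϖ π σ)
  map_add' _ _ := rfl
  map_smul' _ _ := rfl

theorem orbitSpan_D₀_eq_top [π.ρ.IsIrreducible] (hD₁ : D₁ ϖ hϖ π σ ≠ ⊥) :
    orbitSpan π.ρ ((D₀ ϖ hϖ π σ).toSubmodule : Set π.V) = ⊤ :=
  orbitSpan_toSubmodule_eq_top fun h => hD₁ <| Subrepresentation.toSubmodule_injective <|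
    le_bot_iff.1 <| (D₁_le_D₀ ϖ hϖ π σ).trans_eq (congrArg Subrepresentation.toSubmodule h)

theorem isLocallyCompatible_comp {φ₀ : (D₀ ϖ hϖ π σ).toSubmodule →ₗ[k] π'.V}
    {φ₁ : (D₁ ϖ hϖ π σ).toSubmodule →ₗ[k] π'.V}
    (hφ₀ : ∀ h w, φ₀ ((D₀ ϖ hϖ π σ).toRepresentation h w) = π'.ρ h (φ₀ w))
    (hφ₁ : ∀ h w, φ₁ ((D₁ ϖ hϖ π σ).toRepresentation h w) = π'.ρ h (φ₁ w))
    (hr : ∀ w, φ₀ (Submodule.inclusion (D₁_le_D₀ ϖ hϖ π σ) w) = φ₁ w) :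
    IsLocallyCompatible (τ := D₀ ϖ hϖ π σ) ϖ hϖ σ fun g => π'.ρ g ∘ₗ φ₀ where
  mul_mem_KZ g h w := by
    rw [LinearMap.comp_apply, LinearMap.comp_apply, hφ₀, map_mul, Module.End.mul_apply]
  mul_PiMat g w hw := by
    let w₁ : (D₁ ϖ hϖ π σ).toSubmodule := ⟨w, D₀_le_Iplus π σ ϖ hϖ w.2, hw⟩
    let w₂ := (D₁ ϖ hϖ π σ).toRepresentation ⟨_, inv_mem (PiMat_mem_N hϖ)⟩ w₁
    refine ⟨Submodule.inclusion (D₁_le_D₀ ϖ hϖ π σ) w₂, π.ρ.self_inv_apply _ _, ?_⟩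
    rw [LinearMap.comp_apply, LinearMap.comp_apply, hr, hφ₁, map_mul, Module.End.mul_apply,
      π'.ρ.self_inv_apply, ← hr]
    rfl

theorem restrictHom_injective [π.ρ.IsIrreducible] (hD₁ : D₁ ϖ hϖ π σ ≠ ⊥) :
    Function.Injective (restrictHom ϖ hϖ π σ π') := by
  intro φ φ' h
  have h₀ (w : (D₀ ϖ hϖ π σ).toSubmodule) : φ (w : π.V) = φ' w :=
    congrArg (fun f : Diagram.Hom (canonicalDiagram ϖ hϖ π σ) (Diagram.calK π') => f.1.1 w) h
  refine Representation.IntertwiningMap.ext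
    (linearMap_ext_of_orbitSpan_eq_top (orbitSpan_D₀_eq_top hD₁) fun g w hw => ?_)
  change φ (π.ρ g w) = φ' (π.ρ g w)
  rw [φ.isIntertwining, φ'.isIntertwining, h₀ ⟨w, hw⟩]

theorem restrictHom_surjective [π.ρ.IsIrreducible] (hD₁ : D₁ ϖ hϖ π σ ≠ ⊥) :
    Function.Surjective (restrictHom ϖ hϖ π σ π') := by
  intro f
  have hspan := orbitSpan_D₀_eq_top hD₁
  have hcompat := isLocallyCompatible_comp (φ₀ := f.1.1.toLinearMap) (φ₁ := f.1.2.toLinearMap)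
    (f.1.1.isIntertwining _ _) (f.1.2.isIntertwining _ _) f.2
  obtain ⟨Θ, hΘ⟩ := hcompat.exists_linearMap_apply_eq (D₀_le_Iplus π σ ϖ hϖ) hspan
  obtain ⟨Φ, hΦ⟩ := exists_intertwiningMap_apply_eq hspan hΘ
  refine ⟨Φ, Subtype.ext (Prod.ext ?_ ?_)⟩
  · exact Representation.IntertwiningMap.ext (LinearMap.ext hΦ)
  · refine Representation.IntertwiningMap.ext (LinearMap.ext fun w => ?_)
    exact (hΦ (Submodule.inclusion (D₁_le_D₀ ϖ hϖ π σ) w)).trans (f.2 w)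

end Extension

end CanonicalDiagram

theorem mainTheorem1_general
    {F : Type*} [Field F] [ValuativeRel F] [TopologicalSpace F] [IsNonarchimedeanLocalField F]
    {p : ℕ} [Fact p.Prime] [CharP 𝓀[F] p]
    {k : Type*} [Field k] [CharP k p]
    (ϖ : 𝒪[F]) (hϖ : Irreducible ϖ)
    (π : CanonicalDiagram.SmoothRep F k) (hirr : π.ρ.IsIrreducible)
    (hcent : CanonicalDiagram.HasCentralCharacter π.ρ) :
    (∃ σ : Subrepresentation (CanonicalDiagram.res π.ρ (CanonicalDiagram.KZ F)),
      σ.toRepresentation.IsIrreducible) ∧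
    ∀ σ : Subrepresentation (CanonicalDiagram.res π.ρ (CanonicalDiagram.KZ F)),
      σ.toRepresentation.IsIrreducible →
      ∃ e : ∀ π' : CanonicalDiagram.SmoothRep F k,
          CanonicalDiagram.Diagram.Hom (CanonicalDiagram.canonicalDiagram ϖ hϖ π σ)
            (CanonicalDiagram.Diagram.calK π') ≃ₗ[k] π.ρ.IntertwiningMap π'.ρ,
        (∀ (π' : CanonicalDiagram.SmoothRep F k) (φ : π.ρ.IntertwiningMap π'.ρ),
          (e π').symm φ = CanonicalDiagram.Diagram.comp (CanonicalDiagram.Diagram.calK.map φ)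
            (CanonicalDiagram.canonicalDiagram.incl ϖ hϖ π σ)) ∧
        ∀ (π' π'' : CanonicalDiagram.SmoothRep F k) (ψ : π'.ρ.IntertwiningMap π''.ρ)
          (f : CanonicalDiagram.Diagram.Hom (CanonicalDiagram.canonicalDiagram ϖ hϖ π σ)
            (CanonicalDiagram.Diagram.calK π')),
          e π'' (CanonicalDiagram.Diagram.comp (CanonicalDiagram.Diagram.calK.map ψ) f) =
            ψ.comp (e π' f) := by
  have := CanonicalDiagram.nontrivial_of_isIrreducible π.ρ
  refine ⟨CanonicalDiagram.exists_isIrreducible_res_KZ π.smooth hcent, fun σ hσ => ?_⟩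
  have hD₁ : CanonicalDiagram.D₁ ϖ hϖ π σ ≠ ⊥ := CanonicalDiagram.D₁_ne_bot (p := p) hcent hσ
  let e := fun π' : CanonicalDiagram.SmoothRep F k =>
    (LinearEquiv.ofBijective (CanonicalDiagram.restrictHom ϖ hϖ π σ π')
      ⟨CanonicalDiagram.restrictHom_injective hD₁,
        CanonicalDiagram.restrictHom_surjective hD₁⟩).symm
  refine ⟨e, fun π' φ => rfl, fun π' π'' ψ f => ?_⟩
  obtain ⟨φ, rfl⟩ := (e π').symm.surjective f
  rw [LinearEquiv.symm_apply_eq, LinearEquiv.apply_symm_apply]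
  rfl

theorem mainTheorem1
    {F : Type*} [Field F] [ValuativeRel F] [TopologicalSpace F] [IsNonarchimedeanLocalField F]
    {p : ℕ} [Fact p.Prime] [CharP 𝓀[F] p]
    {k : Type*} [Field k] [IsAlgClosed k] [CharP k p]
    (ϖ : 𝒪[F]) (hϖ : Irreducible ϖ)
    (π : CanonicalDiagram.SmoothRep F k) (hirr : π.ρ.IsIrreducible)
    (hcent : CanonicalDiagram.HasCentralCharacter π.ρ) :
    (∃ σ : Subrepresentation (CanonicalDiagram.res π.ρ (CanonicalDiagram.KZ F)),
      σ.toRepresentation.IsIrreducible) ∧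
    ∀ σ : Subrepresentation (CanonicalDiagram.res π.ρ (CanonicalDiagram.KZ F)),
      σ.toRepresentation.IsIrreducible →
      ∃ e : ∀ π' : CanonicalDiagram.SmoothRep F k,
          CanonicalDiagram.Diagram.Hom (CanonicalDiagram.canonicalDiagram ϖ hϖ π σ)
            (CanonicalDiagram.Diagram.calK π') ≃ₗ[k] π.ρ.IntertwiningMap π'.ρ,
        (∀ (π' : CanonicalDiagram.SmoothRep F k) (φ : π.ρ.IntertwiningMap π'.ρ),
          (e π').symm φ = CanonicalDiagram.Diagram.comp (CanonicalDiagram.Diagram.calK.map φ)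
            (CanonicalDiagram.canonicalDiagram.incl ϖ hϖ π σ)) ∧
        ∀ (π' π'' : CanonicalDiagram.SmoothRep F k) (ψ : π'.ρ.IntertwiningMap π''.ρ)
          (f : CanonicalDiagram.Diagram.Hom (CanonicalDiagram.canonicalDiagram ϖ hϖ π σ)
            (CanonicalDiagram.Diagram.calK π')),
          e π'' (CanonicalDiagram.Diagram.comp (CanonicalDiagram.Diagram.calK.map ψ) f) =
            ψ.comp (e π' f) := by
  exact mainTheorem1_general (p := p) ϖ hϖ π hirr hcent
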